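/- Let $n\ge 1$ and $1<p<\infty$. For a function $h:\mathbf R^n\to[0,\infty]$ write $\|h\|_{L^{p,\infty}}=\sup_{\lambda>0}\lambda\,|\{x: h(x)>\lambda\}|^{1/p}$, and let $L^{p,\infty}(\mathbf R^n)$ be the space of measurable complex functions $g$ on $\mathbf R^n$, modulo a.e. equality, with $\|g\|_{L^{p,\infty}}:=\||g|\|_{L^{p,\infty}}<\infty$. A tempered distribution $f$ on $\mathbf R^n$ is called bounded if $\varphi*f\in L^\infty(\mathbf R^n)$ for every Schwartz function $\varphi$. With the Poisson kernel $P(x)=\Gamma(\frac{n+1}{2})\,\pi^{-\frac{n+1}{2}}(1+|x|^2)^{-\frac{n+1}{2}}$ and $P_t(x)=t^{-n}P(x/t)$, the convolution of $P_t$ with a bounded tempered distribution $f$ is the bounded continuous function $P_t*f$ determined by $$\int_{\mathbf R^n}(P_t*f)(x)\,\varphi(x)\,dx=\int_{\mathbf R^n}P_t(-x)\,(\widetilde\varphi*f)(x)\,dx\qquad(\varphi\in\mathcal S(\mathbf R^n)),\qquad \widetilde\varphi(x)=\varphi(-x).$$ The weak Hardy space $H^{p,\infty}(\mathbf R^n)$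 is the space of bounded tempered distributions $f$ with $$\|f\|_{H^{p,\infty}}:=\Big\|\sup_{t>0}|P_t*f|\Big\|_{L^{p,\infty}}<\infty .$$ **Theorem.** The spaces $L^{p,\infty}(\mathbf R^n)$ and $H^{p,\infty}(\mathbf R^n)$ coincide, with equivalent quasi-norms. That is: every $g\in L^{p,\infty}(\mathbf R^n)$ defines a tempered distribution $f_g$ by $\langle f_g,\varphi\rangle=\int_{\mathbf R^n} g\,\varphi\,dx$ (the integral converging absolutely for every Schwartz function $\varphi$); the map $g\mapsto f_g$ is a bijection of $L^{p,\infty}(\mathbf R^n)$ onto $H^{p,\infty}(\mathbf R^n)$; and there is a constant $C>0$, depending only on $n$ and $p$, such that for all $g\in L^{p,\infty}(\mathbf R^n)$ $$\|f_g\|_{H^{p,\infty}}\le C\,\|g\|_{L^{p,\infty}}\qquad\text{and}\qquad \|g\|_{L^{p,\infty}}\le C\,\|f_g\|_{H^{p,\infty}} .$$ -/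

import Mathlib

open MeasureTheory SchwartzMap
open scoped ENNReal NNReal SchwartzMap BoundedContinuousFunction

noncomputable section

namespace WeakHardy

/-- Euclidean space `ℝⁿ`. -/
abbrev E (n : ℕ) : Type := EuclideanSpace ℝ (Fin n)

/-- The weak `L^p` quasi-norm `sup_{λ > 0} λ |{h > λ}|^{1/p}` of a nonnegative function on `ℝⁿ`. -/
def weakNorm {n : ℕ} (p : ℝ) (h : E n → ℝ≥0∞) : ℝ≥0∞ :=
  ⨆ s : ℝ≥0, (s : ℝ≥0∞) * volume {x | (s : ℝ≥0∞) < h x} ^ (1 / p)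

/-- The quasi-norm of `L^{p,∞}(ℝⁿ)`, on classes of measurable functions modulo a.e. equality. -/
def weakLpNorm {n : ℕ} (p : ℝ) (g : E n →ₘ[volume] ℂ) : ℝ≥0∞ :=
  weakNorm p (fun x => ‖g x‖ₑ)

/-- The space `L^{p,∞}(ℝⁿ)`. -/
def weakLp (n : ℕ) (p : ℝ) : Set (E n →ₘ[volume] ℂ) :=
  {g | weakLpNorm p g < ⊤}

/-- The tempered distribution `f` is given by integration against `g`. -/
def IsGivenBy {n : ℕ} (f : 𝓢'(E n, ℂ)) (g : E n →ₘ[volume] ℂ) : Prop :=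
  ∀ φ : 𝓢(E n, ℂ), Integrable (fun x => g x * φ x) ∧ f φ = ∫ x, g x * φ x

/-- The reflection `φ̃(x) = φ(-x)` of a Schwartz function. -/
def reflect {n : ℕ} (φ : 𝓢(E n, ℂ)) : 𝓢(E n, ℂ) :=
  compCLMOfContinuousLinearEquiv ℂ (ContinuousLinearEquiv.neg ℝ) φ

@[simp] theorem reflect_apply {n : ℕ} (φ : 𝓢(E n, ℂ)) (x : E n) : reflect φ x = φ (-x) := rfl

/-- The convolution `(φ * f)(x) = ⟨f, φ(x - ·)⟩` of a Schwartz function with a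
tempered distribution. -/
def schwartzConv {n : ℕ} (φ : 𝓢(E n, ℂ)) (f : 𝓢'(E n, ℂ)) (x : E n) : ℂ :=
  f ((reflect φ).compSubConstCLM ℂ x)

theorem schwartzConv_test {n : ℕ} (φ : 𝓢(E n, ℂ)) (x y : E n) :
    (reflect φ).compSubConstCLM ℂ x y = φ (x - y) := by
  simp

/-- `f` is a bounded tempered distribution: `φ * f` is bounded for every Schwartz function `φ`
(each `φ * f` is smooth, so a bound a.e. is a bound everywhere). -/
def IsBoundedDistribution {n : ℕ} (f : 𝓢'(E n, ℂ)) : Prop :=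
  ∀ φ : 𝓢(E n, ℂ), ∃ C : ℝ, ∀ x, ‖schwartzConv φ f x‖ ≤ C

/-- The convolution `h * f` of an integrable function `h` with a bounded tempered distribution `f`,
as a functional on Schwartz functions: `⟨h * f, φ⟩ = ∫ h(-x) (φ̃ * f)(x) dx`. -/
def distConv {n : ℕ} (h : E n → ℂ) (f : 𝓢'(E n, ℂ)) (φ : 𝓢(E n, ℂ)) : ℂ :=
  ∫ x, h (-x) * schwartzConv (reflect φ) f x

/-- The Poisson kernel `P(x) = Γ((n+1)/2) π^{-(n+1)/2} (1 + |x|²)^{-(n+1)/2}`. -/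
def poisson {n : ℕ} (x : E n) : ℝ :=
  Real.Gamma (((n : ℝ) + 1) / 2) / Real.pi ^ (((n : ℝ) + 1) / 2)
    / (1 + ‖x‖ ^ 2) ^ (((n : ℝ) + 1) / 2)

/-- The dilates `P_t(x) = t^{-n} P(x/t)`. -/
def poissonDilate {n : ℕ} (t : ℝ) (x : E n) : ℝ :=
  (t ^ n)⁻¹ * poisson (t⁻¹ • x)

/-- `u t` is the function `P_t * f` for every `t > 0`. The distribution `P_t * f` is a bounded
continuous function when `f` is a bounded distribution; `IsPoissonExtension.unique` shows that it
is determined by `f`. -/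
def IsPoissonExtension {n : ℕ} (f : 𝓢'(E n, ℂ)) (u : ℝ → (E n →ᵇ ℂ)) : Prop :=
  ∀ t : ℝ, 0 < t → ∀ φ : 𝓢(E n, ℂ),
    ∫ x, u t x * φ x = distConv (fun y => (poissonDilate t y : ℂ)) f φ

/-- The maximal function `sup_{t > 0} |u t x|`. -/
def verticalSup {n : ℕ} (u : ℝ → (E n →ᵇ ℂ)) (x : E n) : ℝ≥0∞ :=
  ⨆ (t : ℝ) (_ : 0 < t), ‖u t x‖ₑ

/-- The quasi-norm `‖sup_{t > 0} |P_t * f|‖_{L^{p,∞}}` of `H^{p,∞}(ℝⁿ)`. The functions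
`P_t * f` are unique, so the infimum is over one value: see
`weakHardyNorm_eq`. -/
def weakHardyNorm {n : ℕ} (p : ℝ) (f : 𝓢'(E n, ℂ)) : ℝ≥0∞ :=
  ⨅ (u : ℝ → (E n →ᵇ ℂ)) (_ : IsPoissonExtension f u), weakNorm p (verticalSup u)

/-- The weak Hardy space `H^{p,∞}(ℝⁿ)`: the bounded tempered distributions whose Poisson maximal
function lies in `L^{p,∞}`. -/
def weakHardy (n : ℕ) (p : ℝ) : Set 𝓢'(E n, ℂ) :=
  {f | IsBoundedDistribution f ∧ weakHardyNorm p f < ⊤}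

theorem eq_of_integral_eq {n : ℕ} {u v : E n →ᵇ ℂ}
    (h : ∀ φ : 𝓢(E n, ℂ), ∫ x, u x * φ x = ∫ x, v x * φ x) : u = v := by
  have hae : ∀ᵐ x, u x = v x := by
    refine ae_eq_of_integral_contDiff_smul_eq u.continuous.locallyIntegrable
      v.continuous.locallyIntegrable fun g hg hc => ?_
    have h1 : HasCompactSupport (Complex.ofRealCLM ∘ g) := hc.comp_left rfl
    have h2 : ContDiff ℝ ((⊤ : ℕ∞) : WithTop ℕ∞) (Complex.ofRealCLM ∘ g) := by fun_prop
    simpa [mul_comm] using h (h1.toSchwartzMap h2)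
  have := (Continuous.ae_eq_iff_eq volume u.continuous v.continuous).1 hae
  exact DFunLike.coe_injective this

theorem IsPoissonExtension.unique {n : ℕ} {f : 𝓢'(E n, ℂ)} {u v : ℝ → (E n →ᵇ ℂ)}
    (hu : IsPoissonExtension f u) (hv : IsPoissonExtension f v) (t : ℝ) (ht : 0 < t) :
    u t = v t :=
  eq_of_integral_eq fun φ => (hu t ht φ).trans (hv t ht φ).symm

theorem weakHardyNorm_eq {n : ℕ} (p : ℝ) {f : 𝓢'(E n, ℂ)} {u : ℝ → (E n →ᵇ ℂ)}
    (hu : IsPoissonExtension f u) : weakHardyNorm p f = weakNorm p (verticalSup u) := by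
  refine le_antisymm (iInf₂_le u hu) (le_iInf₂ fun v hv => le_of_eq ?_)
  congr 1
  funext x
  unfold verticalSup
  refine iSup_congr fun t => iSup_congr fun ht => ?_
  rw [hu.unique hv t ht]

end WeakHardy

end

/-!
Both inclusions compare a function with its Poisson extension, using that `L^{p,∞} ⊂ L¹ + L^∞` for
`1 < p`: the part of a function above height one is a sum of dyadic layers whose integrals decay
geometrically (`setLIntegral_lt_le_weakNorm`). Hence integration against `g ∈ L^{p,∞}` is a bounded
tempered distribution, and it determines `g`.

*From functions to distributions.* The kernel `P` is dominated by a convergent sum of multiples of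
indicators of dyadic balls, so `sup_t |P_t * g|` is at most a constant times the Hardy–Littlewood
maximal function of `g` (`lintegral_mul_poissonDilate_le`). The latter is bounded on `L^{p,∞}` by
the weak type `(1,1)` inequality, applied at height `s` to the part of `g` above `s / 2`
(`weakNorm_maximalFunction_le`). That `x ↦ ∫ g(y) P_t(x - y) dy` is the extension `P_t * f_g` is
Fubini's theorem (`exists_isPoissonExtension`).

*From distributions to functions.* Let `f` be a bounded distribution with maximal function
`U = sup_t |P_t * f|` in `L^{p,∞}`. For a Schwartz function `φ`, the pairing of `P_t * f` with `φ`
is the integral of `P_t(-x)` against the bounded continuous function `φ̃ * f`, so it tends to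
`(∫ P) ⟨f, φ⟩` as `t → 0`. Therefore `(∫ P) |⟨f, φ⟩| ≤ ∫ U |φ|` (`enorm_le_lintegral_verticalSup`).
By Hahn–Banach, `f` extends to a functional on `L¹(U dx)`, and such a functional is integration
against a bounded density (`exists_isGivenBy_of_enorm_le`). So `f` is a function `g` with
`|g| ≤ (∫ P)⁻¹ U` almost everywhere. This yields surjectivity and, by uniqueness of `g`, also the
bound of `‖g‖` by `‖f_g‖`. The value of `∫ P` is irrelevant: only `0 < ∫ P < ∞` is used.
-/

namespace WeakHardy

open Metric Set

/-! ### The weak `L^p` quasi-norm -/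

theorem weakNorm_mono_ae {n : ℕ} {p : ℝ} (hp : 0 < p) {h k : E n → ℝ≥0∞}
    (hk : ∀ᵐ x, h x ≤ k x) : weakNorm p h ≤ weakNorm p k := by
  refine iSup_mono fun s => mul_le_mul_right (ENNReal.rpow_le_rpow (measure_mono_ae ?_)
    (by positivity)) _
  filter_upwards [hk] with x hx using fun h1 => lt_of_lt_of_le h1 hx

theorem weakNorm_const_mul_le {n : ℕ} {p : ℝ} {c : ℝ≥0} (hc : c ≠ 0) (h : E n → ℝ≥0∞) :
    weakNorm p (fun x => c * h x) ≤ c * weakNorm p h := by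
  refine iSup_le fun s => ?_
  have h1 : {x | (s : ℝ≥0∞) < c * h x} = {x | ((s / c : ℝ≥0) : ℝ≥0∞) < h x} := by
    ext x
    have hc' : (c : ℝ≥0∞) ≠ 0 := by simpa using hc
    simp only [mem_ofPred_eq, ENNReal.coe_div hc]
    rw [ENNReal.div_lt_iff (Or.inl hc') (Or.inl ENNReal.coe_ne_top), mul_comm]
  have h2 : (s : ℝ≥0∞) = c * ((s / c : ℝ≥0) : ℝ≥0∞) := by
    rw [← ENNReal.coe_mul, mul_div_cancel₀ _ hc]
  rw [h1]
  conv_lhs => rw [h2]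
  rw [mul_assoc]
  exact mul_le_mul_right (le_iSup
    (fun s : ℝ≥0 => (s : ℝ≥0∞) * volume {x | (s : ℝ≥0∞) < h x} ^ (1 / p)) (s / c)) _

theorem volume_lt_le_weakNorm {n : ℕ} {p : ℝ} (hp : 0 < p) (h : E n → ℝ≥0∞) {s : ℝ≥0∞}
    (hs : s ≠ 0) (hs' : s ≠ ⊤) : volume {x | s < h x} ≤ (weakNorm p h / s) ^ p := by
  lift s to ℝ≥0 using hs'
  have h1 : (s : ℝ≥0∞) * volume {x | (s : ℝ≥0∞) < h x} ^ (1 / p) ≤ weakNorm p h :=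
    le_iSup (fun s : ℝ≥0 => (s : ℝ≥0∞) * volume {x | (s : ℝ≥0∞) < h x} ^ (1 / p)) s
  have h2 : volume {x | (s : ℝ≥0∞) < h x} ^ (1 / p) ≤ weakNorm p h / s := by
    rw [ENNReal.le_div_iff_mul_le (Or.inl hs) (Or.inl ENNReal.coe_ne_top), mul_comm]
    exact h1
  calc volume {x | (s : ℝ≥0∞) < h x} = (volume {x | (s : ℝ≥0∞) < h x} ^ (1 / p)) ^ p := by
        rw [← ENNReal.rpow_mul, one_div_mul_cancel hp.ne', ENNReal.rpow_one]
    _ ≤ _ := ENNReal.rpow_le_rpow h2 hp.le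

/-- A number above `a` is at most the sum of `2^{k+1} a` over the dyadic levels `2^k a` below it;
the estimate holds for `y = ⊤` as well. -/
theorem le_tsum_dyadic {a y : ℝ≥0∞} (ha : a ≠ 0) (hy : a < y) :
    y ≤ ∑' k : ℕ, if 2 ^ k * a < y then 2 ^ (k + 1) * a else 0 := by
  by_cases hy' : y = ⊤
  · have ha' : a ≠ ⊤ := hy.ne_top
    have : ∀ k : ℕ, a ≤ if 2 ^ k * a < y then 2 ^ (k + 1) * a else 0 := fun k => by
      rw [if_pos (by rw [hy']; exact ENNReal.mul_lt_top (by simp) ha'.lt_top)]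
      exact le_mul_of_one_le_left' (one_le_pow₀ one_le_two)
    refine le_trans ?_ (ENNReal.tsum_le_tsum this)
    rw [ENNReal.tsum_const_eq_top_of_ne_zero ha]
    exact le_top
  · have hex : ∃ k : ℕ, y ≤ 2 ^ k * a := by
      obtain ⟨N, hN⟩ := ENNReal.exists_nat_mul_gt ha hy'
      refine ⟨N, hN.le.trans (mul_le_mul_left ?_ _)⟩
      exact_mod_cast Nat.lt_two_pow_self.le
    classical
    have h0 : Nat.find hex ≠ 0 := fun h => by
      have := Nat.find_spec hex
      rw [h] at this
      simp only [pow_zero, one_mul] at this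
      exact absurd hy this.not_gt
    obtain ⟨k, hk⟩ := Nat.exists_eq_succ_of_ne_zero h0
    refine le_trans ?_ (ENNReal.le_tsum k)
    have h1 : 2 ^ k * a < y := not_le.1 (Nat.find_min hex (by omega))
    rw [if_pos h1]
    have := Nat.find_spec hex
    rwa [hk] at this

/-- The constant `2 ∑ₖ 2^{k(1-p)}` of the dyadic decomposition of a weak `L^p` function. -/
noncomputable def dyadicConst (p : ℝ) : ℝ≥0∞ := 2 * ∑' k : ℕ, ((2 : ℝ≥0∞) ^ (1 - p)) ^ k

theorem dyadicConst_ne_top {p : ℝ} (hp : 1 < p) : dyadicConst p ≠ ⊤ := by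
  unfold dyadicConst
  rw [ENNReal.tsum_geometric]
  refine ENNReal.mul_ne_top (by simp) (ENNReal.inv_ne_top.2 (tsub_pos_of_lt ?_).ne')
  exact ENNReal.rpow_lt_one_of_one_lt_of_neg (by simp) (by linarith)

/-- The part of a weak `L^p` function above a height `a > 0` is integrable; this is where `1 < p`
enters. -/
theorem setLIntegral_lt_le_weakNorm {n : ℕ} {p : ℝ} (hp : 1 < p) {h : E n → ℝ≥0∞}
    (hm : Measurable h) {a : ℝ≥0∞} (ha : a ≠ 0) (ha' : a ≠ ⊤) :
    ∫⁻ x in {x | a < h x}, h x ≤ dyadicConst p * a * (weakNorm p h / a) ^ p := by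
  have hms : ∀ b : ℝ≥0∞, MeasurableSet {x | b < h x} := fun b => hm measurableSet_Ioi
  calc ∫⁻ x in {x | a < h x}, h x
      ≤ ∫⁻ x, ∑' k : ℕ, {x | 2 ^ k * a < h x}.indicator (fun _ => 2 ^ (k + 1) * a) x := by
        rw [← lintegral_indicator (hms a)]
        refine lintegral_mono fun x => ?_
        by_cases hx : a < h x
        swap
        · simp [indicator_of_notMem (show x ∉ {x | a < h x} from hx)]
        rw [indicator_of_mem (show x ∈ {x | a < h x} from hx)]
        refine (le_tsum_dyadic ha hx).trans (le_of_eq ?_)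
        simp only [indicator_apply, mem_ofPred_eq]
    _ = ∑' k : ℕ, 2 ^ (k + 1) * a * volume {x | 2 ^ k * a < h x} := by
        rw [lintegral_tsum fun k => (measurable_const.indicator (hms _)).aemeasurable]
        exact tsum_congr fun k => by rw [lintegral_indicator_const (hms _)]
    _ ≤ ∑' k : ℕ, 2 * a * (weakNorm p h / a) ^ p * ((2 : ℝ≥0∞) ^ (1 - p)) ^ k := by
        refine ENNReal.tsum_le_tsum fun k => ?_
        have h2 : (2 : ℝ≥0∞) ^ k ≠ 0 := by simp
        have h2' : (2 : ℝ≥0∞) ^ k ≠ ⊤ := by simp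
        have hv := volume_lt_le_weakNorm (zero_lt_one.trans hp) h (s := 2 ^ k * a)
          (mul_ne_zero h2 ha) (ENNReal.mul_ne_top h2' ha')
        have h3 : (2 : ℝ≥0∞) ^ k * ((2 : ℝ≥0∞) ^ k)⁻¹ ^ p = ((2 : ℝ≥0∞) ^ (1 - p)) ^ k := by
          rw [ENNReal.inv_rpow, ← ENNReal.rpow_natCast, ← ENNReal.rpow_mul, ← ENNReal.rpow_neg,
            ← ENNReal.rpow_add _ _ (by simp) (by simp), ← ENNReal.rpow_natCast, ← ENNReal.rpow_mul]
          congr 1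
          ring
        have h4 : weakNorm p h / (2 ^ k * a) = (weakNorm p h / a) * ((2 : ℝ≥0∞) ^ k)⁻¹ := by
          rw [div_eq_mul_inv, ENNReal.mul_inv (Or.inl h2) (Or.inl h2'), div_eq_mul_inv]
          ring
        rw [h4, ENNReal.mul_rpow_of_nonneg _ _ (zero_lt_one.trans hp).le] at hv
        calc 2 ^ (k + 1) * a * volume {x | 2 ^ k * a < h x}
            ≤ 2 ^ (k + 1) * a * ((weakNorm p h / a) ^ p * ((2 : ℝ≥0∞) ^ k)⁻¹ ^ p) :=
              mul_le_mul_right hv _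
          _ = 2 * a * (weakNorm p h / a) ^ p * ((2 : ℝ≥0∞) ^ k * ((2 : ℝ≥0∞) ^ k)⁻¹ ^ p) := by
              ring
          _ = _ := by rw [h3]
    _ = _ := by
        rw [ENNReal.tsum_mul_left, dyadicConst]
        ring

/-! ### The Hardy–Littlewood maximal function -/

/-- The centred Hardy–Littlewood maximal function, over closed balls. -/
noncomputable def maximalFunction {n : ℕ} (h : E n → ℝ≥0∞) (x : E n) : ℝ≥0∞ :=
  ⨆ (r : ℝ) (_ : 0 < r), (volume (closedBall x r))⁻¹ * ∫⁻ y in closedBall x r, h y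

theorem setLIntegral_closedBall_le {n : ℕ} (h : E n → ℝ≥0∞) (x : E n) {r : ℝ} (hr : 0 < r) :
    ∫⁻ y in closedBall x r, h y ≤ volume (closedBall x r) * maximalFunction h x := by
  have h0 : volume (closedBall x r) ≠ 0 := (measure_closedBall_pos volume x hr).ne'
  have h1 : volume (closedBall x r) ≠ ⊤ := measure_closedBall_lt_top.ne
  rw [← ENNReal.div_le_iff' h0 h1, div_eq_mul_inv, mul_comm]
  exact le_iSup₂ (f := fun (r : ℝ) (_ : 0 < r) =>
    (volume (closedBall x r))⁻¹ * ∫⁻ y in closedBall x r, h y) r hr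

/-- The weak type `(1,1)` inequality, from the Vitali covering lemma with enlargement factor `5`. -/
theorem volume_lt_maximalFunction_le {n : ℕ} (hn : 0 < n) (h : E n → ℝ≥0∞) {s : ℝ≥0∞}
    (hs : s ≠ 0) (hs' : s ≠ ⊤) :
    volume {x | s < maximalFunction h x} ≤ 5 ^ n / s * ∫⁻ x, h x := by
  by_cases hI : ∫⁻ x, h x = ⊤
  · rw [hI, ENNReal.mul_top (ENNReal.div_ne_zero.2 ⟨by simp, hs'⟩)]
    exact le_top
  have hsel : ∀ x : E n, ∃ r : ℝ, s < maximalFunction h x →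
      0 < r ∧ s * volume (closedBall x r) < ∫⁻ y in closedBall x r, h y := by
    intro x
    by_cases hx : s < maximalFunction h x
    · obtain ⟨r, hr⟩ := lt_iSup_iff.1 hx
      obtain ⟨hr0, hr⟩ := lt_iSup_iff.1 hr
      refine ⟨r, fun _ => ⟨hr0, ?_⟩⟩
      have h0 : volume (closedBall x r) ≠ 0 := (measure_closedBall_pos volume x hr0).ne'
      have h1 : volume (closedBall x r) ≠ ⊤ := measure_closedBall_lt_top.ne
      rw [mul_comm, ← div_eq_mul_inv] at hr
      exact (ENNReal.lt_div_iff_mul_lt (Or.inl h0) (Or.inl h1)).1 hr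
    · exact ⟨0, fun h => absurd h hx⟩
  choose r hr using hsel
  have hv : ∀ (x : E n) {ρ : ℝ}, 0 ≤ ρ → volume (closedBall x ρ) =
      ENNReal.ofReal (ρ ^ n) * volume (closedBall (0 : E n) 1) := fun x ρ hρ => by
    have := Measure.addHaar_closedBall' (volume : Measure (E n)) x hρ
    simpa using this
  have hv0 : volume (closedBall (0 : E n) 1) ≠ 0 :=
    (measure_closedBall_pos volume _ one_pos).ne'
  have hv1 : volume (closedBall (0 : E n) 1) ≠ ⊤ := measure_closedBall_lt_top.ne
  -- since `n ≠ 0`, the selected radii are bounded in terms of the integral of `h`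
  obtain ⟨R, hR⟩ : ∃ R : ℝ, ∀ x ∈ {x | s < maximalFunction h x}, r x ≤ R := by
    set T : ℝ≥0∞ := (∫⁻ x, h x) / (s * volume (closedBall (0 : E n) 1)) with hT
    have hTt : T ≠ ⊤ := ENNReal.div_ne_top hI (mul_ne_zero hs hv0)
    refine ⟨max 1 T.toReal, fun x hx => ?_⟩
    obtain ⟨h0, h1⟩ := hr x hx
    by_contra! hcon
    have h1r : 1 ≤ r x := (le_max_left _ _).trans hcon.le
    have hpow : r x ≤ r x ^ n := le_self_pow₀ h1r hn.ne'
    have h2 : ENNReal.ofReal (r x ^ n) ≤ T := by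
      rw [hT, ENNReal.le_div_iff_mul_le (Or.inl (mul_ne_zero hs hv0))
        (Or.inl (ENNReal.mul_ne_top hs' hv1))]
      calc ENNReal.ofReal (r x ^ n) * (s * volume (closedBall (0 : E n) 1))
          = s * volume (closedBall x (r x)) := by rw [hv x h0.le]; ring
        _ ≤ ∫⁻ y in closedBall x (r x), h y := h1.le
        _ ≤ ∫⁻ x, h x := setLIntegral_le_lintegral _ _
    have h3 := (ENNReal.ofReal_le_iff_le_toReal hTt).1 h2
    exact absurd ((le_max_right 1 _).trans_lt hcon) (by linarith)
  obtain ⟨u, hut, hdisj, hcov⟩ := Vitali.exists_disjoint_subfamily_covering_enlargement_closedBall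
    {x | s < maximalFunction h x} id r R hR 5 (by norm_num)
  have hcount : u.Countable := hdisj.countable_of_nonempty_interior fun a ha => by
    refine ⟨a, ?_⟩
    exact ball_subset_interior_closedBall (mem_ball_self (hr a (hut ha)).1)
  calc volume {x | s < maximalFunction h x}
      ≤ volume (⋃ b ∈ u, closedBall b (5 * r b)) := by
        refine measure_mono fun x hx => ?_
        obtain ⟨b, hb, hsub⟩ := hcov x hx
        exact mem_biUnion hb (hsub (mem_closedBall_self (hr x hx).1.le))
    _ ≤ ∑' b : u, volume (closedBall (b : E n) (5 * r b)) := measure_biUnion_le _ hcount _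
    _ ≤ ∑' b : u, 5 ^ n / s * ∫⁻ y in closedBall (b : E n) (r b), h y := by
        refine ENNReal.tsum_le_tsum fun b => ?_
        obtain ⟨h0, h1⟩ := hr b (hut b.2)
        have h5 : volume (closedBall (b : E n) (5 * r b)) =
            5 ^ n * volume (closedBall (b : E n) (r b)) := by
          rw [hv _ (by positivity), hv _ h0.le, mul_pow, ENNReal.ofReal_mul (by positivity),
            ENNReal.ofReal_pow (by norm_num)]
          norm_num
          ring
        rw [h5, div_eq_mul_inv, mul_assoc]
        refine mul_le_mul_right ?_ _
        rw [mul_comm, ← div_eq_mul_inv, ENNReal.le_div_iff_mul_le (Or.inl hs) (Or.inl hs'),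
          mul_comm]
        exact h1.le
    _ = 5 ^ n / s * ∫⁻ y in ⋃ b ∈ u, closedBall b (r b), h y := by
        rw [ENNReal.tsum_mul_left]
        exact congrArg _ (lintegral_biUnion hcount (fun b _ => measurableSet_closedBall)
          hdisj h).symm
    _ ≤ _ := mul_le_mul_right (setLIntegral_le_lintegral _ _) _

theorem maximalFunction_le_add {n : ℕ} {h : E n → ℝ≥0∞} (hm : Measurable h) (a : ℝ≥0∞)
    (x : E n) :
    maximalFunction h x ≤ a + maximalFunction ({x | a < h x}.indicator h) x := by
  refine iSup₂_le fun r hr => ?_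
  have h0 : volume (closedBall x r) ≠ 0 := (measure_closedBall_pos volume x hr).ne'
  have h1 : volume (closedBall x r) ≠ ⊤ := measure_closedBall_lt_top.ne
  have hms : MeasurableSet {x | a < h x} := hm measurableSet_Ioi
  calc (volume (closedBall x r))⁻¹ * ∫⁻ y in closedBall x r, h y
      ≤ (volume (closedBall x r))⁻¹ *
          ∫⁻ y in closedBall x r, (a + {x | a < h x}.indicator h y) := by
        refine mul_le_mul_right (lintegral_mono fun y => ?_) _
        by_cases hy : a < h y
        · simp [indicator_of_mem (show y ∈ {x | a < h x} from hy)]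
        · exact le_add_right (not_lt.1 hy)
    _ = a + (volume (closedBall x r))⁻¹ *
          ∫⁻ y in closedBall x r, {x | a < h x}.indicator h y := by
        rw [lintegral_add_left measurable_const, mul_add, setLIntegral_const, mul_left_comm,
          ENNReal.inv_mul_cancel h0 h1, mul_one]
    _ ≤ _ := add_le_add_right (le_iSup₂ (f := fun (r : ℝ) (_ : 0 < r) =>
        (volume (closedBall x r))⁻¹ * ∫⁻ y in closedBall x r, {x | a < h x}.indicator h y) r hr) _

/-- The maximal function is bounded on weak `L^p` for `1 < p`: at height `s`, only the part of `h`
above `s / 2` matters, and this part is integrable. -/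
theorem weakNorm_maximalFunction_le {n : ℕ} (hn : 0 < n) {p : ℝ} (hp : 1 < p) {h : E n → ℝ≥0∞}
    (hm : Measurable h) :
    weakNorm p (maximalFunction h) ≤ 2 * (5 ^ n * dyadicConst p) ^ (1 / p) * weakNorm p h := by
  have hp0 : 0 < p := zero_lt_one.trans hp
  refine iSup_le fun s => ?_
  rcases eq_or_ne s 0 with rfl | hs
  · simp
  have ha : (s : ℝ≥0∞) / 2 ≠ 0 := by simpa using hs
  have ha' : (s : ℝ≥0∞) / 2 ≠ ⊤ := ENNReal.div_ne_top (by simp) (by simp)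
  set a : ℝ≥0∞ := (s : ℝ≥0∞) / 2 with hadef
  have hsa : (s : ℝ≥0∞) = a + a := (ENNReal.add_halves _).symm
  have hvol : volume {x | (s : ℝ≥0∞) < maximalFunction h x} ≤
      5 ^ n * dyadicConst p * (weakNorm p h / a) ^ p := by
    calc volume {x | (s : ℝ≥0∞) < maximalFunction h x}
        ≤ volume {x | a < maximalFunction ({x | a < h x}.indicator h) x} := by
          refine measure_mono fun x hx => ?_
          have h1 : a + a < a + maximalFunction ({x | a < h x}.indicator h) x := by
            rw [← hsa]
            exact lt_of_lt_of_le hx (maximalFunction_le_add hm a x)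
          exact lt_of_add_lt_add_left h1
      _ ≤ 5 ^ n / a * ∫⁻ x, {x | a < h x}.indicator h x :=
          volume_lt_maximalFunction_le hn _ ha ha'
      _ ≤ 5 ^ n / a * (dyadicConst p * a * (weakNorm p h / a) ^ p) := by
          rw [lintegral_indicator (show MeasurableSet {x | a < h x} from hm measurableSet_Ioi)]
          exact mul_le_mul_right (setLIntegral_lt_le_weakNorm hp hm ha ha') _
      _ = 5 ^ n * dyadicConst p * (weakNorm p h / a) ^ p * (a * a⁻¹) := by
          rw [div_eq_mul_inv]
          ring
      _ = _ := by rw [ENNReal.mul_inv_cancel ha ha', mul_one]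
  calc (s : ℝ≥0∞) * volume {x | (s : ℝ≥0∞) < maximalFunction h x} ^ (1 / p)
      ≤ s * (5 ^ n * dyadicConst p * (weakNorm p h / a) ^ p) ^ (1 / p) :=
        mul_le_mul_right (ENNReal.rpow_le_rpow hvol (by positivity)) _
    _ = 2 * a * ((5 ^ n * dyadicConst p) ^ (1 / p) * (weakNorm p h / a)) := by
        rw [ENNReal.mul_rpow_of_nonneg _ _ (by positivity), ← ENNReal.rpow_mul,
          mul_one_div_cancel hp0.ne', ENNReal.rpow_one, hsa, two_mul]
    _ = 2 * (5 ^ n * dyadicConst p) ^ (1 / p) * (weakNorm p h) * (a * a⁻¹) := by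
        rw [div_eq_mul_inv (weakNorm p h)]
        ring
    _ = _ := by rw [ENNReal.mul_inv_cancel ha ha', mul_one]

/-! ### Functionals dominated by a weighted `L¹` norm -/

/-- The part of the duality between `L¹` and `L^∞` needed below. A functional on `L¹(μ)` of norm at
most one composed with multiplication by `w ∈ L²(μ)` is represented in `L²(μ)` by the Riesz
representation theorem, and testing against the phase of the representing function bounds it
by `w`. -/
theorem exists_density_of_norm_le_one {α : Type*} [MeasurableSpace α] {μ : Measure α}
    (Λ : Lp ℂ 1 μ →L[ℂ] ℂ) (hΛ : ‖Λ‖ ≤ 1) {w : α → ℝ} (hwm : Measurable w) (hw : MemLp w 2 μ)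
    (hpos : ∀ x, 0 < w x) :
    ∃ k : α → ℂ, Measurable k ∧ (∀ x, ‖k x‖ ≤ 1) ∧
      ∀ ψ : α → ℂ, MemLp ψ 2 μ → ∀ F : Lp ℂ 1 μ, (F =ᵐ[μ] fun x => w x * ψ x) →
        Λ F = ∫ x, k x * (w x * ψ x) ∂μ := by
  have hwc : MemLp (fun x => (w x : ℂ)) 2 μ := hw.ofReal
  let T : Lp ℂ 2 μ →L[ℂ] Lp ℂ 1 μ :=
    (ContinuousLinearMap.mul ℂ ℂ).holderL μ 2 2 1 hwc.toLp
  have hT : ∀ ψ : Lp ℂ 2 μ, T ψ =ᵐ[μ] fun x => (w x : ℂ) * ψ x := fun ψ => by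
    have h1 := (ContinuousLinearMap.mul ℂ ℂ).coeFn_holder (r := 1) hwc.toLp ψ
    filter_upwards [h1, hwc.coeFn_toLp] with x hx hx'
    rw [ContinuousLinearMap.mul_apply', hx'] at hx
    exact hx
  let H : Lp ℂ 2 μ := (InnerProductSpace.toDual ℂ (Lp ℂ 2 μ)).symm (Λ.comp T)
  have hH : ∀ ψ : Lp ℂ 2 μ, Λ (T ψ) = ∫ x, ψ x * (starRingEnd ℂ) (H x) ∂μ := fun ψ => by
    have h1 : inner ℂ H ψ = (Λ.comp T) ψ := InnerProductSpace.toDual_symm_apply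
    rw [L2.inner_def] at h1
    exact h1.symm
  have hHm : Measurable H := (Lp.stronglyMeasurable H).measurable
  set S : Set α := {x | w x < ‖H x‖} with hS
  have hSm : MeasurableSet S := measurableSet_lt hwm hHm.norm
  have hHw : ∀ᵐ x ∂μ, ‖H x‖ ≤ w x := by
    -- testing against `ψ` gives `∫_S w |H| ≤ ∫_S w²`, while `w < |H|` on `S`
    let ψ : α → ℂ := S.indicator fun x => w x * (H x / ‖H x‖)
    have hψm : Measurable ψ := by
      refine Measurable.indicator ?_ hSm
      fun_prop
    have hψw : ∀ x, ‖ψ x‖ ≤ w x := fun x => by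
      by_cases hx : x ∈ S
      · have h0 : ‖H x‖ ≠ 0 := ((hpos x).trans hx).ne'
        simp [ψ, indicator_of_mem hx, h0, abs_of_pos (hpos x)]
      · simp [ψ, indicator_of_notMem hx, (hpos x).le]
    have hψ : MemLp ψ 2 μ := hw.mono hψm.aestronglyMeasurable <| .of_forall fun x => by
      rw [Real.norm_of_nonneg (hpos x).le]
      exact hψw x
    have h1 : Λ (T hψ.toLp) = ((∫ x, S.indicator (fun x => w x * ‖H x‖) x ∂μ : ℝ) : ℂ) := by
      rw [hH, ← integral_complex_ofReal]
      refine integral_congr_ae ?_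
      filter_upwards [hψ.coeFn_toLp] with x hx
      rw [hx]
      by_cases hxS : x ∈ S
      · have h0 : (‖H x‖ : ℂ) ≠ 0 := by exact_mod_cast ((hpos x).trans hxS).ne'
        simp only [ψ, indicator_of_mem hxS]
        push_cast
        rw [mul_assoc, div_mul_eq_mul_div, Complex.mul_conj, Complex.normSq_eq_norm_sq]
        push_cast
        field_simp
      · simp [ψ, indicator_of_notMem hxS]
    have h2 : ‖T hψ.toLp‖ = ∫ x, S.indicator (fun x => w x * w x) x ∂μ := by
      rw [L1.norm_eq_integral_norm]
      refine integral_congr_ae ?_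
      filter_upwards [hT hψ.toLp, hψ.coeFn_toLp] with x hx hx'
      rw [hx, hx']
      by_cases hxS : x ∈ S
      · have h0 : ‖H x‖ ≠ 0 := ((hpos x).trans hxS).ne'
        simp [ψ, indicator_of_mem hxS, h0, abs_of_pos (hpos x)]
      · simp [ψ, indicator_of_notMem hxS]
    have hi1 : Integrable (S.indicator fun x => w x * ‖H x‖) μ :=
      (hw.integrable_mul (Lp.memLp H).norm).indicator hSm
    have hi2 : Integrable (S.indicator fun x => w x * w x) μ :=
      (hw.integrable_mul hw).indicator hSm
    have h3 : ∫ x, S.indicator (fun x => w x * ‖H x‖) x ∂μ ≤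
        ∫ x, S.indicator (fun x => w x * w x) x ∂μ := by
      have h4 := (Λ.le_opNorm (T hψ.toLp)).trans (mul_le_of_le_one_left (norm_nonneg _) hΛ)
      rw [h1, h2, Complex.norm_real] at h4
      exact (le_abs_self _).trans h4
    have h5 : ∫ x, (S.indicator (fun x => w x * ‖H x‖) x - S.indicator (fun x => w x * w x) x) ∂μ
        ≤ 0 := by
      rw [integral_sub hi1 hi2]
      linarith
    have hnn : ∀ x, 0 ≤ S.indicator (fun x => w x * ‖H x‖) x -
        S.indicator (fun x => w x * w x) x := fun x => by
      by_cases hxS : x ∈ S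
      · have : w x < ‖H x‖ := hxS
        simp only [indicator_of_mem hxS]
        nlinarith [hpos x]
      · simp [indicator_of_notMem hxS]
    have h6 := (integral_eq_zero_iff_of_nonneg hnn (hi1.sub hi2)).1
      (le_antisymm h5 (integral_nonneg hnn))
    filter_upwards [h6] with x hx
    by_contra! hxS
    have hxS' : x ∈ S := hxS
    simp only [indicator_of_mem hxS', Pi.zero_apply] at hx
    nlinarith [hpos x]
  refine ⟨Sᶜ.indicator fun x => (starRingEnd ℂ) (H x) / w x, ?_, fun x => ?_, fun ψ hψ F hF => ?_⟩
  · refine Measurable.indicator ?_ hSm.compl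
    have : Measurable fun x => (starRingEnd ℂ) (H x) := Complex.continuous_conj.measurable.comp hHm
    fun_prop
  · by_cases hx : x ∈ S
    · simp [hx]
    · have : ‖H x‖ ≤ w x := not_lt.1 hx
      simp only [indicator_of_mem (show x ∈ Sᶜ from hx), norm_div, RCLike.norm_conj,
        Complex.norm_real, Real.norm_of_nonneg (hpos x).le]
      exact div_le_one_of_le₀ this (hpos x).le
  · have hFT : F = T hψ.toLp := by
      refine Lp.ext ?_
      filter_upwards [hF, hT hψ.toLp, hψ.coeFn_toLp] with x h1 h2 h3
      rw [h1, h2, h3]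
    rw [hFT, hH]
    refine integral_congr_ae ?_
    filter_upwards [hψ.coeFn_toLp, hHw] with x h1 h2
    have h0 : (w x : ℂ) ≠ 0 := by exact_mod_cast (hpos x).ne'
    rw [h1, indicator_of_mem (show x ∈ Sᶜ from not_lt.2 h2)]
    field_simp

/-- A linear functional `f` on a vector space dominated by `‖J ·‖` for a linear map `J` factors
through `J` as a functional of norm at most one (Hahn–Banach). -/
theorem exists_dual_comp_eq_of_le_norm {X Y : Type*} [AddCommGroup X] [Module ℂ X]
    [NormedAddCommGroup Y] [NormedSpace ℂ Y] (J : X →ₗ[ℂ] Y) (f : X →ₗ[ℂ] ℂ)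
    (hf : ∀ x, ‖f x‖ ≤ ‖J x‖) : ∃ Λ : Y →L[ℂ] ℂ, ‖Λ‖ ≤ 1 ∧ ∀ x, Λ (J x) = f x := by
  obtain ⟨s, hs⟩ := J.rangeRestrict.exists_rightInverse_of_surjective J.range_rangeRestrict
  have hs' : ∀ y : LinearMap.range J, J (s y) = y := fun y => by
    have := congrArg (fun l => ((l y : LinearMap.range J) : Y)) hs
    simpa using this
  obtain ⟨Λ, h1, h2⟩ := exists_extension_norm_eq (𝕜 := ℂ) (LinearMap.range J)
    ((f ∘ₗ s).mkContinuous 1 fun y => by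
      rw [one_mul]
      calc ‖f (s y)‖ ≤ ‖J (s y)‖ := hf _
        _ = ‖y‖ := by rw [hs' y]; rfl)
  refine ⟨Λ, h2.trans_le (LinearMap.mkContinuous_norm_le _ zero_le_one _), fun x => ?_⟩
  have h3 := h1 ⟨J x, LinearMap.mem_range_self J x⟩
  have h4 := hf (s ⟨J x, LinearMap.mem_range_self J x⟩ - x)
  rw [map_sub, map_sub, hs', sub_self, norm_zero, norm_le_zero_iff, sub_eq_zero] at h4
  exact h3.trans h4

/-- A tempered distribution dominated by `φ ↦ ∫ V |φ|` is a function bounded by `V`. -/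
theorem exists_isGivenBy_of_enorm_le {n : ℕ} (f : 𝓢'(E n, ℂ)) {V : E n → ℝ≥0∞}
    (hV : Measurable V) (hVtop : ∀ᵐ x, V x < ⊤)
    (hgrowth : (volume.withDensity V).HasTemperateGrowth)
    (hf : ∀ φ : 𝓢(E n, ℂ), ‖f φ‖ₑ ≤ ∫⁻ x, V x * ‖φ x‖ₑ) :
    ∃ g : E n →ₘ[volume] ℂ, IsGivenBy f g ∧ ∀ᵐ x, ‖g x‖ₑ ≤ V x := by
  set ν : Measure (E n) := volume.withDensity V with hν
  have hJ : ∀ φ : 𝓢(E n, ℂ), ‖f φ‖ ≤ ‖φ.toLp 1 ν‖ := fun φ => by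
    rw [← enorm_le_iff_norm_le]
    refine (hf φ).trans (le_of_eq ?_)
    rw [Lp.enorm_def, eLpNorm_congr_ae (φ.coeFn_toLp 1 ν), eLpNorm_one_eq_lintegral_enorm,
      hν, lintegral_withDensity_eq_lintegral_mul _ hV φ.continuous.enorm.measurable]
    rfl
  obtain ⟨Λ, hΛ, hΛf⟩ := exists_dual_comp_eq_of_le_norm
    (toLpCLM ℂ ℂ 1 ν : 𝓢(E n, ℂ) →L[ℂ] Lp ℂ 1 ν).toLinearMap
    (f : 𝓢(E n, ℂ) →L[ℂ] ℂ).toLinearMap hJ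
  -- the weight `w` is in `L²(ν)`, and dividing by it preserves Schwartz functions
  set m : ℕ := ν.integrablePower with hm
  let w : E n → ℝ := fun x => (1 + ‖x‖ ^ 2) ^ (-(m : ℝ))
  have hpos : ∀ x, 0 < w x := fun x => by positivity
  have hwm : Measurable w := by
    have : Continuous w := by
      refine Continuous.rpow_const (by fun_prop) fun x => Or.inl (by positivity)
    exact this.measurable
  have hw : MemLp w 2 ν := by
    rw [memLp_two_iff_integrable_sq hwm.aestronglyMeasurable]
    refine ((Measure.integrable_pow_neg_integrablePower ν).const_mul (2 ^ m)).mono'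
      (hwm.pow_const 2).aestronglyMeasurable (.of_forall fun x => ?_)
    have h1 : (1 + ‖x‖) ≤ 2 * (1 + ‖x‖ ^ 2) := by nlinarith [sq_nonneg (‖x‖ - 1), norm_nonneg x]
    have h2 : w x ≤ 1 := Real.rpow_le_one_of_one_le_of_nonpos (by nlinarith [norm_nonneg x])
      (by simp)
    have h3 : w x ≤ 2 ^ m * (1 + ‖x‖) ^ (-(m : ℝ)) := by
      simp only [w, Real.rpow_neg (show (0 : ℝ) ≤ 1 + ‖x‖ ^ 2 by positivity),
        Real.rpow_neg (show (0 : ℝ) ≤ 1 + ‖x‖ by positivity), Real.rpow_natCast]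
      rw [← div_eq_mul_inv, inv_eq_one_div, div_le_div_iff₀ (by positivity) (by positivity),
        one_mul, ← mul_pow]
      exact pow_le_pow_left₀ (by positivity) h1 m
    rw [Real.norm_of_nonneg (by positivity)]
    nlinarith [hpos x]
  obtain ⟨k, hkm, hk1, hk⟩ := exists_density_of_norm_le_one Λ hΛ hwm hw hpos
  have hfk : ∀ φ : 𝓢(E n, ℂ), f φ = ∫ x, k x * φ x ∂ν := fun φ => by
    let ψ : 𝓢(E n, ℂ) := smulLeftCLM ℂ (fun x : E n => (1 + ‖x‖ ^ 2) ^ (m : ℝ)) φ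
    have hψ : ∀ x, w x * ψ x = φ x := fun x => by
      have h1 : w x * (1 + ‖x‖ ^ 2) ^ (m : ℝ) = 1 := by
        simp only [w]
        rw [← Real.rpow_add (by positivity), neg_add_cancel, Real.rpow_zero]
      simp only [ψ]
      rw [smulLeftCLM_apply_apply (Function.hasTemperateGrowth_one_add_norm_sq_rpow _ _),
        Complex.real_smul, ← mul_assoc, ← Complex.ofReal_mul, h1, Complex.ofReal_one, one_mul]
    have h2 := hk ψ (ψ.memLp 2 ν) (φ.toLp 1 ν) (by
      filter_upwards [φ.coeFn_toLp 1 ν] with x hx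
      rw [hx, hψ])
    simp only [hψ] at h2
    rw [← h2]
    exact (hΛf φ).symm
  have hgm : Measurable fun x => ((V x).toReal : ℂ) * k x := by fun_prop
  have hint : ∀ φ : 𝓢(E n, ℂ), Integrable (fun x => k x * φ x) ν := fun φ =>
    φ.integrable.bdd_mul (c := 1) hkm.aestronglyMeasurable (.of_forall hk1)
  refine ⟨AEEqFun.mk _ hgm.aestronglyMeasurable, fun φ => ?_, ?_⟩
  · have hae : (fun x => (AEEqFun.mk _ hgm.aestronglyMeasurable : E n →ₘ[volume] ℂ) x * φ x)
        =ᵐ[volume] fun x => (V x).toReal • (k x * φ x) := by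
      filter_upwards [AEEqFun.coeFn_mk _ hgm.aestronglyMeasurable] with x hx
      rw [hx, Complex.real_smul, mul_assoc]
    refine ⟨Integrable.congr ?_ hae.symm, ?_⟩
    · exact (integrable_withDensity_iff_integrable_smul' hV hVtop).1 (hint φ)
    · rw [hfk φ, integral_congr_ae hae, hν, integral_withDensity_eq_integral_toReal_smul hV hVtop]
  · filter_upwards [AEEqFun.coeFn_mk _ hgm.aestronglyMeasurable, hVtop] with x hx hx'
    rw [hx, enorm_mul]
    calc ‖((V x).toReal : ℂ)‖ₑ * ‖k x‖ₑ ≤ V x * 1 := by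
          refine mul_le_mul' (le_of_eq ?_) ?_
          · rw [← ofReal_norm, Complex.norm_real, Real.norm_of_nonneg ENNReal.toReal_nonneg,
              ENNReal.ofReal_toReal hx'.ne]
          · rw [← ofReal_norm]
            exact ENNReal.ofReal_le_one.2 (hk1 x)
      _ = V x := mul_one _

/-! ### Weak `L^p` as a subspace of `L¹ + L^∞` -/

theorem setLIntegral_one_lt_lt_top {n : ℕ} {p : ℝ} (hp : 1 < p) {V : E n → ℝ≥0∞}
    (hV : Measurable V) (hfin : weakNorm p V < ⊤) : ∫⁻ x in {x | 1 < V x}, V x < ⊤ := by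
  refine (setLIntegral_lt_le_weakNorm hp hV one_ne_zero ENNReal.one_ne_top).trans_lt ?_
  rw [mul_one, div_one]
  exact ENNReal.mul_lt_top (dyadicConst_ne_top hp).lt_top
    (ENNReal.rpow_lt_top_of_nonneg (by linarith) hfin.ne)

theorem lintegral_mul_le_add {n : ℕ} {V : E n → ℝ≥0∞} (hV : Measurable V) {Q : E n → ℝ≥0∞}
    {B : ℝ≥0∞} (hQ : ∀ x, Q x ≤ B) :
    ∫⁻ x, V x * Q x ≤ (∫⁻ x in {x | 1 < V x}, V x) * B + ∫⁻ x, Q x := by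
  have hms : MeasurableSet {x | 1 < V x} := hV measurableSet_Ioi
  have hi : Measurable ({x | 1 < V x}.indicator V) := hV.indicator hms
  calc ∫⁻ x, V x * Q x ≤ ∫⁻ x, ({x | 1 < V x}.indicator V x * B + Q x) := by
        refine lintegral_mono fun x => ?_
        by_cases hx : 1 < V x
        · rw [indicator_of_mem (show x ∈ {x | 1 < V x} from hx)]
          exact le_add_right (mul_le_mul_right (hQ x) _)
        · exact le_add_left (mul_le_of_le_one_left zero_le (not_lt.1 hx))
    _ = _ := by
        rw [lintegral_add_left (hi.mul_const B), lintegral_mul_const _ hi, lintegral_indicator hms]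

theorem ae_lt_top_of_weakNorm_lt_top {n : ℕ} {p : ℝ} (hp : 1 < p) {V : E n → ℝ≥0∞}
    (hV : Measurable V) (hfin : weakNorm p V < ⊤) : ∀ᵐ x, V x < ⊤ := by
  have hms : MeasurableSet {x | 1 < V x} := hV measurableSet_Ioi
  have h1 : ∀ᵐ x, {x | 1 < V x}.indicator V x < ⊤ := by
    refine ae_lt_top (hV.indicator hms) ?_
    rw [lintegral_indicator hms]
    exact (setLIntegral_one_lt_lt_top hp hV hfin).ne
  filter_upwards [h1] with x hx
  by_cases h : 1 < V x
  · rwa [indicator_of_mem (show x ∈ {x | 1 < V x} from h)] at hx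
  · exact (not_lt.1 h).trans_lt ENNReal.one_lt_top

/-- Schwartz functions are integrable against a weak `L^p` density. -/
theorem hasTemperateGrowth_withDensity {n : ℕ} {p : ℝ} (hp : 1 < p) {V : E n → ℝ≥0∞}
    (hV : Measurable V) (hfin : weakNorm p V < ⊤) :
    (volume.withDensity V).HasTemperateGrowth := by
  have hdim : (Module.finrank ℝ (E n) : ℝ) < ((n + 1 : ℕ) : ℝ) := by simp
  have hint := integrable_one_add_norm (μ := (volume : Measure (E n))) hdim
  have hc : Continuous fun x : E n => (1 + ‖x‖) ^ (-((n + 1 : ℕ) : ℝ)) :=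
    Continuous.rpow_const (by fun_prop) fun x => Or.inl (by positivity)
  refine ⟨n + 1, hc.aestronglyMeasurable, ?_⟩
  rw [HasFiniteIntegral, lintegral_withDensity_eq_lintegral_mul _ hV hc.enorm.measurable]
  refine (lintegral_mul_le_add (B := 1) hV fun x => ?_).trans_lt ?_
  · rw [← ofReal_norm, Real.norm_of_nonneg (by positivity), ENNReal.ofReal_le_one]
    exact Real.rpow_le_one_of_one_le_of_nonpos (by linarith [norm_nonneg x])
      (neg_nonpos.2 (Nat.cast_nonneg _))
  · rw [mul_one]
    exact ENNReal.add_lt_top.2 ⟨setLIntegral_one_lt_lt_top hp hV hfin, hint.2⟩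

theorem measurable_enorm_aeeqFun {n : ℕ} (g : E n →ₘ[volume] ℂ) :
    Measurable fun x => ‖g x‖ₑ := g.measurable.enorm

theorem locallyIntegrable_of_mem_weakLp {n : ℕ} {p : ℝ} (hp : 1 < p) {g : E n →ₘ[volume] ℂ}
    (hg : g ∈ weakLp n p) : LocallyIntegrable g := by
  refine (locallyIntegrable_iff).2 fun K hK => ⟨g.aestronglyMeasurable.restrict, ?_⟩
  have h1 : ∫⁻ x, ‖g x‖ₑ * K.indicator (fun _ => 1) x < ⊤ := by
    refine (lintegral_mul_le_add (B := 1) (measurable_enorm_aeeqFun g) fun x => ?_).trans_lt ?_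
    · exact indicator_le_self' (fun _ _ => zero_le) x
    · rw [mul_one]
      refine ENNReal.add_lt_top.2
        ⟨setLIntegral_one_lt_lt_top hp (measurable_enorm_aeeqFun g) hg, ?_⟩
      rw [lintegral_indicator_const hK.measurableSet, one_mul]
      exact hK.measure_lt_top
  rw [HasFiniteIntegral, ← lintegral_indicator hK.measurableSet]
  refine lt_of_le_of_lt (lintegral_mono fun x => ?_) h1
  by_cases hx : x ∈ K <;> simp [hx]

/-- A function in `L¹ + L^∞` is determined by its integrals against Schwartz functions. -/
theorem IsGivenBy.unique {n : ℕ} {f : 𝓢'(E n, ℂ)} {g k : E n →ₘ[volume] ℂ}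
    (hg : IsGivenBy f g) (hk : IsGivenBy f k) (hgl : LocallyIntegrable g)
    (hkl : LocallyIntegrable k) : g = k := by
  refine AEEqFun.ext (ae_eq_of_integral_contDiff_smul_eq hgl hkl fun φ hφ hc => ?_)
  have h1 : HasCompactSupport (Complex.ofRealCLM ∘ φ) := hc.comp_left rfl
  have h2 : ContDiff ℝ ((⊤ : ℕ∞) : WithTop ℕ∞) (Complex.ofRealCLM ∘ φ) := by fun_prop
  have h3 := (hg (h1.toSchwartzMap h2)).2.symm.trans (hk (h1.toSchwartzMap h2)).2
  simpa [mul_comm] using h3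

/-- A weak `L^p` function defines a tempered distribution, as the sum of its parts in `L¹` and
`L^∞`. -/
theorem exists_isGivenBy {n : ℕ} {p : ℝ} (hp : 1 < p) {g : E n →ₘ[volume] ℂ}
    (hg : g ∈ weakLp n p) : ∃ f : 𝓢'(E n, ℂ), IsGivenBy f g := by
  set S : Set (E n) := {x | 1 < ‖g x‖ₑ} with hS
  have hSm : MeasurableSet S := measurable_enorm_aeeqFun g measurableSet_Ioi
  have h1 : MemLp (S.indicator g) 1 volume := by
    refine ⟨g.aestronglyMeasurable.indicator hSm, ?_⟩
    rw [eLpNorm_one_eq_lintegral_enorm]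
    simp_rw [enorm_indicator_eq_indicator_enorm]
    rw [lintegral_indicator hSm]
    exact setLIntegral_one_lt_lt_top hp (measurable_enorm_aeeqFun g) hg
  have h2 : MemLp (Sᶜ.indicator g) ⊤ volume := by
    refine memLp_top_of_bound (g.aestronglyMeasurable.indicator hSm.compl) 1
      (.of_forall fun x => ?_)
    by_cases hx : x ∈ S
    · simp [hx]
    · rw [indicator_of_mem (show x ∈ Sᶜ from hx)]
      have : ‖g x‖ₑ ≤ 1 := not_lt.1 hx
      rw [← ofReal_norm] at this
      exact ENNReal.ofReal_le_one.1 this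
  refine ⟨Lp.toTemperedDistribution h1.toLp + Lp.toTemperedDistribution h2.toLp, fun φ => ?_⟩
  have i1 : Integrable fun x => S.indicator g x * φ x :=
    (memLp_one_iff_integrable.1 h1).mul_bdd (c := SchwartzMap.seminorm ℝ 0 0 φ)
      φ.continuous.aestronglyMeasurable (.of_forall fun x => φ.norm_le_seminorm ℝ x)
  have i2 : Integrable fun x => Sᶜ.indicator g x * φ x :=
    (memLp_one_iff_integrable.1 ((φ.memLp 1).mul h2))
  have e : (fun x => g x * φ x) = fun x => S.indicator g x * φ x + Sᶜ.indicator g x * φ x := by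
    funext x
    rw [← add_mul, indicator_self_add_compl_apply]
  refine ⟨by rw [e]; exact i1.add i2, ?_⟩
  rw [e, integral_add i1 i2]
  have e1 : Lp.toTemperedDistribution h1.toLp φ = ∫ x, S.indicator g x * φ x := by
    rw [Lp.toTemperedDistribution_apply]
    refine integral_congr_ae ?_
    filter_upwards [h1.coeFn_toLp] with x hx
    rw [hx, smul_eq_mul, mul_comm]
  have e2 : Lp.toTemperedDistribution h2.toLp φ = ∫ x, Sᶜ.indicator g x * φ x := by
    rw [Lp.toTemperedDistribution_apply]
    refine integral_congr_ae ?_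
    filter_upwards [h2.coeFn_toLp] with x hx
    rw [hx, smul_eq_mul, mul_comm]
  rw [← e1, ← e2]
  rfl

/-- The bound `‖g₁‖₁ ‖Q‖_∞ + ‖g₂‖_∞ ‖Q‖₁` for `g * Q`, with `g₁` the part of `g` above height `1`
and `g₂ = g - g₁`. -/
theorem lintegral_enorm_mul_comp_sub_le {n : ℕ} (g : E n →ₘ[volume] ℂ) {Q : E n → ℂ} {B : ℝ≥0∞}
    (hQ : ∀ x, ‖Q x‖ₑ ≤ B) (x : E n) :
    ∫⁻ y, ‖g y * Q (x - y)‖ₑ ≤ (∫⁻ y in {y | 1 < ‖g y‖ₑ}, ‖g y‖ₑ) * B + ∫⁻ y, ‖Q y‖ₑ := by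
  simp_rw [enorm_mul]
  refine (lintegral_mul_le_add (measurable_enorm_aeeqFun g) fun y => hQ (x - y)).trans (le_of_eq ?_)
  rw [lintegral_sub_left_eq_self (fun y => ‖Q y‖ₑ) x]

theorem integrable_mul_comp_sub {n : ℕ} {p : ℝ} (hp : 1 < p) {g : E n →ₘ[volume] ℂ}
    (hg : g ∈ weakLp n p) {Q : E n → ℂ} (hQc : Continuous Q) (hQi : Integrable Q) {B : ℝ≥0∞}
    (hB : B ≠ ⊤) (hQ : ∀ x, ‖Q x‖ₑ ≤ B) (x : E n) : Integrable fun y => g y * Q (x - y) := by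
  refine ⟨g.aestronglyMeasurable.mul (by fun_prop), ?_⟩
  refine (lintegral_enorm_mul_comp_sub_le g hQ x).trans_lt (ENNReal.add_lt_top.2 ⟨?_, hQi.2⟩)
  exact ENNReal.mul_lt_top (setLIntegral_one_lt_lt_top hp (measurable_enorm_aeeqFun g) hg)
    hB.lt_top

theorem exists_lintegral_enorm_mul_comp_sub_le {n : ℕ} {p : ℝ} (hp : 1 < p) {g : E n →ₘ[volume] ℂ}
    (hg : g ∈ weakLp n p) {Q : E n → ℂ} (hQi : Integrable Q) {B : ℝ≥0∞}
    (hB : B ≠ ⊤) (hQ : ∀ x, ‖Q x‖ₑ ≤ B) :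
    ∃ C : ℝ≥0, ∀ x, ∫⁻ y, ‖g y * Q (x - y)‖ₑ ≤ C := by
  have h : (∫⁻ y in {y | 1 < ‖g y‖ₑ}, ‖g y‖ₑ) * B + ∫⁻ y, ‖Q y‖ₑ ≠ ⊤ :=
    (ENNReal.add_lt_top.2 ⟨ENNReal.mul_lt_top
      (setLIntegral_one_lt_lt_top hp (measurable_enorm_aeeqFun g) hg) hB.lt_top, hQi.2⟩).ne
  refine ⟨((∫⁻ y in {y | 1 < ‖g y‖ₑ}, ‖g y‖ₑ) * B + ∫⁻ y, ‖Q y‖ₑ).toNNReal, fun x => ?_⟩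
  rw [ENNReal.coe_toNNReal h]
  exact lintegral_enorm_mul_comp_sub_le g hQ x

theorem enorm_schwartz_le_seminorm {n : ℕ} (φ : 𝓢(E n, ℂ)) (x : E n) :
    ‖φ x‖ₑ ≤ ENNReal.ofReal (SchwartzMap.seminorm ℝ 0 0 φ) := by
  rw [← ofReal_norm]
  exact ENNReal.ofReal_le_ofReal (φ.norm_le_seminorm ℝ x)

theorem schwartzConv_eq_integral {n : ℕ} {f : 𝓢'(E n, ℂ)} {g : E n →ₘ[volume] ℂ}
    (hf : IsGivenBy f g) (φ : 𝓢(E n, ℂ)) (x : E n) :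
    schwartzConv φ f x = ∫ y, g y * φ (x - y) := by
  rw [schwartzConv, (hf _).2]
  simp_rw [schwartzConv_test]

theorem isBoundedDistribution_of_isGivenBy {n : ℕ} {p : ℝ} (hp : 1 < p) {g : E n →ₘ[volume] ℂ}
    (hg : g ∈ weakLp n p) {f : 𝓢'(E n, ℂ)} (hf : IsGivenBy f g) : IsBoundedDistribution f := by
  intro φ
  obtain ⟨C, hC⟩ := exists_lintegral_enorm_mul_comp_sub_le hp hg φ.integrable
    ENNReal.ofReal_ne_top (enorm_schwartz_le_seminorm φ)
  refine ⟨C, fun x => ?_⟩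
  rw [schwartzConv_eq_integral hf]
  have := (enorm_integral_le_lintegral_enorm (fun y => g y * φ (x - y))).trans (hC x)
  exact_mod_cast this

/-! ### The Poisson kernel -/

/-- The constant `Γ((n+1)/2) π^{-(n+1)/2}` of the Poisson kernel. -/
noncomputable def poissonConst (n : ℕ) : ℝ :=
  Real.Gamma (((n : ℝ) + 1) / 2) / Real.pi ^ (((n : ℝ) + 1) / 2)

theorem poissonConst_pos (n : ℕ) : 0 < poissonConst n :=
  div_pos (Real.Gamma_pos_of_pos (by positivity)) (Real.rpow_pos_of_pos Real.pi_pos _)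

theorem poisson_eq {n : ℕ} (x : E n) :
    poisson x = poissonConst n / (1 + ‖x‖ ^ 2) ^ (((n : ℝ) + 1) / 2) := rfl

theorem poisson_pos {n : ℕ} (x : E n) : 0 < poisson x := by
  rw [poisson_eq]
  exact div_pos (poissonConst_pos n) (by positivity)

theorem poisson_le {n : ℕ} (x : E n) : poisson x ≤ poissonConst n := by
  rw [poisson_eq]
  exact div_le_self (poissonConst_pos n).le (Real.one_le_rpow (by nlinarith [norm_nonneg x])
    (by positivity))

theorem continuous_poisson {n : ℕ} : Continuous (poisson : E n → ℝ) := by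
  refine Continuous.div continuous_const ?_ fun x => by positivity
  exact Continuous.rpow_const (by fun_prop) fun x => Or.inl (by positivity)

theorem integrable_poisson {n : ℕ} : Integrable (poisson : E n → ℝ) := by
  have hdim : (Module.finrank ℝ (E n) : ℝ) < (n : ℝ) + 1 := by simp
  refine ((integrable_rpow_neg_one_add_norm_sq (μ := (volume : Measure (E n))) hdim).const_mul
    (poissonConst n)).congr (.of_forall fun x => ?_)
  simp only [poisson_eq]
  rw [neg_div, Real.rpow_neg (by positivity), ← div_eq_mul_inv]

theorem integral_poisson_pos {n : ℕ} : 0 < ∫ x : E n, poisson x := by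
  rw [integral_pos_iff_support_of_nonneg (fun x => (poisson_pos x).le) integrable_poisson]
  have : Function.support (poisson : E n → ℝ) = univ := by
    ext x
    simp [(poisson_pos x).ne']
  rw [this]
  exact isOpen_univ.measure_pos _ univ_nonempty

/-- Harnack-type inequality: the Poisson kernel is comparable at points of distance at most one. -/
theorem poisson_add_le {n : ℕ} (a : E n) {b : E n} (hb : ‖b‖ ≤ 1) :
    poisson (a + b) ≤ 3 ^ (((n : ℝ) + 1) / 2) * poisson a := by
  have h1 : ‖a‖ ≤ ‖a + b‖ + 1 := by
    have := norm_sub_le (a + b) b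
    rw [add_sub_cancel_right] at this
    linarith
  have h2 : 1 + ‖a‖ ^ 2 ≤ 3 * (1 + ‖a + b‖ ^ 2) := by
    nlinarith [norm_nonneg a, norm_nonneg (a + b), sq_nonneg (‖a + b‖ - 1)]
  have h3 := Real.rpow_le_rpow (by positivity) h2 (show (0 : ℝ) ≤ ((n : ℝ) + 1) / 2 by positivity)
  rw [Real.mul_rpow (by norm_num) (by positivity)] at h3
  rw [poisson_eq, poisson_eq, mul_div_assoc', div_le_div_iff₀ (by positivity) (by positivity)]
  nlinarith [poissonConst_pos n]

/-- The Poisson kernel is dominated by a rapidly converging series of indicators of dyadic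
balls. -/
theorem ofReal_poisson_le_tsum {n : ℕ} (x : E n) :
    ENNReal.ofReal (poisson x) ≤ ∑' k : ℕ, (closedBall (0 : E n) (2 ^ k)).indicator
      (fun _ => ENNReal.ofReal (poissonConst n * 2 ^ (n + 1) * (2 ^ (k * (n + 1)))⁻¹)) x := by
  have key : ∃ k : ℕ, ‖x‖ ≤ 2 ^ k ∧
      poisson x ≤ poissonConst n * 2 ^ (n + 1) * (2 ^ (k * (n + 1)))⁻¹ := by
    rcases le_or_gt ‖x‖ 1 with hx | hx
    · refine ⟨0, by simpa using hx, (poisson_le x).trans ?_⟩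
      simp only [zero_mul, pow_zero, inv_one, mul_one]
      exact le_mul_of_one_le_right (poissonConst_pos n).le (one_le_pow₀ one_le_two)
    · obtain ⟨k, hk, hk'⟩ := exists_nat_pow_near hx.le (one_lt_two : (1 : ℝ) < 2)
      refine ⟨k + 1, hk'.le, ?_⟩
      have h1 : (2 : ℝ) ^ (k * (n + 1)) ≤ (1 + ‖x‖ ^ 2) ^ (((n : ℝ) + 1) / 2) := by
        calc (2 : ℝ) ^ (k * (n + 1)) = (2 ^ k) ^ (n + 1) := pow_mul _ _ _
          _ ≤ ‖x‖ ^ (n + 1) := pow_le_pow_left₀ (by positivity) hk _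
          _ = (‖x‖ ^ 2) ^ (((n : ℝ) + 1) / 2) := by
              rw [← Real.rpow_natCast_mul (norm_nonneg x), ← Real.rpow_natCast]
              congr 1
              push_cast
              ring
          _ ≤ _ := Real.rpow_le_rpow (by positivity) (by linarith) (by positivity)
      have h2 : poissonConst n * 2 ^ (n + 1) * (2 ^ ((k + 1) * (n + 1)))⁻¹ =
          poissonConst n / 2 ^ (k * (n + 1)) := by
        rw [add_mul, one_mul, pow_add 2 (k * (n + 1)) (n + 1)]
        field_simp
      rw [poisson_eq, h2]
      exact div_le_div_of_nonneg_left (poissonConst_pos n).le (by positivity) h1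
  obtain ⟨k, hk, hle⟩ := key
  refine le_trans ?_ (ENNReal.le_tsum k)
  rw [indicator_of_mem (by simpa using hk)]
  exact ENNReal.ofReal_le_ofReal hle

theorem poissonDilate_pos {n : ℕ} {t : ℝ} (ht : 0 < t) (x : E n) : 0 < poissonDilate t x :=
  mul_pos (by positivity) (poisson_pos _)

theorem poissonDilate_le {n : ℕ} {t : ℝ} (ht : 0 < t) (x : E n) :
    poissonDilate t x ≤ (t ^ n)⁻¹ * poissonConst n :=
  mul_le_mul_of_nonneg_left (poisson_le _) (by positivity)

theorem continuous_poissonDilate {n : ℕ} (t : ℝ) : Continuous (poissonDilate t : E n → ℝ) :=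
  continuous_const.mul (continuous_poisson.comp (continuous_const_smul _))

theorem integrable_poissonDilate {n : ℕ} {t : ℝ} (ht : 0 < t) :
    Integrable (poissonDilate t : E n → ℝ) :=
  (integrable_poisson.comp_smul (inv_ne_zero ht.ne')).const_mul _

theorem poissonDilate_add_le {n : ℕ} {t : ℝ} (ht : 0 < t) (a : E n) {b : E n} (hb : ‖b‖ ≤ t) :
    poissonDilate t (a + b) ≤ 3 ^ (((n : ℝ) + 1) / 2) * poissonDilate t a := by
  have h1 : ‖t⁻¹ • b‖ ≤ 1 := by
    rw [norm_smul, Real.norm_of_nonneg (by positivity), inv_mul_le_iff₀ ht, mul_one]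
    exact hb
  rw [poissonDilate, poissonDilate, smul_add, mul_left_comm]
  exact mul_le_mul_of_nonneg_left (poisson_add_le _ h1) (by positivity)

theorem enorm_poissonDilate_le {n : ℕ} {t : ℝ} (ht : 0 < t) (x : E n) :
    ‖(poissonDilate t x : ℂ)‖ₑ ≤ ENNReal.ofReal ((t ^ n)⁻¹ * poissonConst n) := by
  rw [← ofReal_norm, Complex.norm_real, Real.norm_of_nonneg (poissonDilate_pos ht x).le]
  exact ENNReal.ofReal_le_ofReal (poissonDilate_le ht x)

/-- The constant in the bound of Poisson averages by the maximal function. -/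
noncomputable def poissonMaximalConst (n : ℕ) : ℝ≥0∞ :=
  ENNReal.ofReal (poissonConst n * 2 ^ (n + 1)) * volume (closedBall (0 : E n) 1) * 2

theorem poissonMaximalConst_ne_top (n : ℕ) : poissonMaximalConst n ≠ ⊤ :=
  ENNReal.mul_ne_top (ENNReal.mul_ne_top ENNReal.ofReal_ne_top measure_closedBall_lt_top.ne)
    (by simp)

/-- Poisson averages are bounded by the maximal function, uniformly in `t`. -/
theorem lintegral_mul_poissonDilate_le {n : ℕ} {h : E n → ℝ≥0∞} (hm : Measurable h) {t : ℝ}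
    (ht : 0 < t) (x : E n) :
    ∫⁻ y, h y * ENNReal.ofReal (poissonDilate t (x - y)) ≤
      poissonMaximalConst n * maximalFunction h x := by
  set c : ℕ → ℝ≥0∞ := fun k =>
    ENNReal.ofReal (poissonConst n * 2 ^ (n + 1) * (2 ^ (k * (n + 1)))⁻¹) with hc
  have hpt : ∀ y, ENNReal.ofReal (poissonDilate t (x - y)) ≤
      ∑' k : ℕ, ENNReal.ofReal (t ^ n)⁻¹ * c k *
        (closedBall x (t * 2 ^ k)).indicator (fun _ => 1) y := fun y => by
    rw [poissonDilate, ENNReal.ofReal_mul (by positivity)]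
    simp_rw [mul_assoc]
    rw [ENNReal.tsum_mul_left]
    refine mul_le_mul_right ((ofReal_poisson_le_tsum _).trans (ENNReal.tsum_le_tsum fun k => ?_)) _
    by_cases hy : t⁻¹ • (x - y) ∈ closedBall (0 : E n) (2 ^ k)
    · rw [indicator_of_mem hy, indicator_of_mem, mul_one]
      rw [mem_closedBall_zero_iff, norm_smul, Real.norm_of_nonneg (by positivity),
        inv_mul_le_iff₀ ht] at hy
      rwa [mem_closedBall, dist_comm, dist_eq_norm]
    · rw [indicator_of_notMem hy]
      exact zero_le
  have hmi : ∀ k : ℕ, MeasurableSet (closedBall x (t * 2 ^ k)) := fun k => measurableSet_closedBall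
  calc ∫⁻ y, h y * ENNReal.ofReal (poissonDilate t (x - y))
      ≤ ∫⁻ y, ∑' k : ℕ, ENNReal.ofReal (t ^ n)⁻¹ * c k *
          (closedBall x (t * 2 ^ k)).indicator h y := by
        refine lintegral_mono fun y => (mul_le_mul_right (hpt y) _).trans (le_of_eq ?_)
        rw [← ENNReal.tsum_mul_left]
        refine tsum_congr fun k => ?_
        by_cases hy : y ∈ closedBall x (t * 2 ^ k)
        · rw [indicator_of_mem hy, indicator_of_mem hy]
          ring
        · rw [indicator_of_notMem hy, indicator_of_notMem hy]
          ring
    _ = ∑' k : ℕ, ENNReal.ofReal (t ^ n)⁻¹ * c k * ∫⁻ y in closedBall x (t * 2 ^ k), h y := by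
        rw [lintegral_tsum fun k => ((hm.indicator (hmi k)).const_mul _).aemeasurable]
        refine tsum_congr fun k => ?_
        rw [lintegral_const_mul _ (hm.indicator (hmi k)), lintegral_indicator (hmi k)]
    _ ≤ ∑' k : ℕ, ENNReal.ofReal (t ^ n)⁻¹ * c k *
          (volume (closedBall x (t * 2 ^ k)) * maximalFunction h x) :=
        ENNReal.tsum_le_tsum fun k =>
          mul_le_mul_right (setLIntegral_closedBall_le h x (by positivity)) _
    _ = ∑' k : ℕ, ENNReal.ofReal (poissonConst n * 2 ^ (n + 1)) *
          volume (closedBall (0 : E n) 1) * maximalFunction h x * (2⁻¹ : ℝ≥0∞) ^ k := by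
        refine tsum_congr fun k => ?_
        have hv : volume (closedBall x (t * 2 ^ k)) =
            ENNReal.ofReal ((t * 2 ^ k) ^ n) * volume (closedBall (0 : E n) 1) := by
          have := Measure.addHaar_closedBall' (volume : Measure (E n)) x
            (show 0 ≤ t * 2 ^ k by positivity)
          simpa using this
        have hk : (2⁻¹ : ℝ≥0∞) ^ k = ENNReal.ofReal ((2 ^ k)⁻¹) := by
          rw [ENNReal.ofReal_inv_of_pos (by positivity), ENNReal.ofReal_pow (by norm_num),
            ENNReal.inv_pow]
          norm_num
        have hreal : (t ^ n)⁻¹ * (poissonConst n * 2 ^ (n + 1) * (2 ^ (k * (n + 1)))⁻¹) *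
            (t * 2 ^ k) ^ n = poissonConst n * 2 ^ (n + 1) * (2 ^ k)⁻¹ := by
          rw [mul_add k n 1, pow_add 2 (k * n), mul_one k, mul_pow, pow_mul]
          field_simp
        have hP := (poissonConst_pos n).le
        have he : ENNReal.ofReal (t ^ n)⁻¹ * c k * ENNReal.ofReal ((t * 2 ^ k) ^ n) =
            ENNReal.ofReal (poissonConst n * 2 ^ (n + 1)) * ENNReal.ofReal ((2 ^ k)⁻¹) := by
          rw [hc, ← ENNReal.ofReal_mul (by positivity), ← ENNReal.ofReal_mul (by positivity),
            hreal, ENNReal.ofReal_mul (by positivity)]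
        rw [hv, hk]
        calc _ = (ENNReal.ofReal (t ^ n)⁻¹ * c k * ENNReal.ofReal ((t * 2 ^ k) ^ n)) *
              volume (closedBall (0 : E n) 1) * maximalFunction h x := by ring
          _ = _ := by rw [he]; ring
    _ = _ := by
        rw [ENNReal.tsum_mul_left, ENNReal.tsum_geometric_two, poissonMaximalConst]
        ring

/-! ### The Poisson extension of a weak `L^p` function -/

/-- `P_t * g` is continuous: for `|x - x₀| < t` the integrand at `x` is dominated by a multiple of
the integrand at `x₀`. -/
theorem continuous_integral_mul_poissonDilate {n : ℕ} {p : ℝ} (hp : 1 < p)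
    {g : E n →ₘ[volume] ℂ} (hg : g ∈ weakLp n p) {t : ℝ} (ht : 0 < t) :
    Continuous fun x => ∫ y, g y * (poissonDilate t (x - y) : ℂ) := by
  have hcont := continuous_poissonDilate (n := n) t
  refine continuous_iff_continuousAt.2 fun x₀ => ?_
  have hint : Integrable fun y => g y * (poissonDilate t (x₀ - y) : ℂ) :=
    integrable_mul_comp_sub hp hg (Complex.continuous_ofReal.comp hcont)
      (integrable_poissonDilate ht).ofReal ENNReal.ofReal_ne_top (enorm_poissonDilate_le ht) x₀
  refine continuousAt_of_dominated (.of_forall fun x => ?_) ?_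
    (hint.norm.const_mul (3 ^ (((n : ℝ) + 1) / 2))) (.of_forall fun y => ?_)
  · exact g.aestronglyMeasurable.mul
      (Continuous.aestronglyMeasurable (by fun_prop))
  · filter_upwards [ball_mem_nhds x₀ ht] with x hx
    refine .of_forall fun y => ?_
    have h1 : x - y = (x₀ - y) + (x - x₀) := by abel
    have h2 := poissonDilate_add_le ht (x₀ - y) (mem_ball_iff_norm.1 hx).le
    rw [← h1] at h2
    rw [norm_mul, norm_mul, Complex.norm_real, Complex.norm_real,
      Real.norm_of_nonneg (poissonDilate_pos ht _).le,
      Real.norm_of_nonneg (poissonDilate_pos ht _).le, mul_left_comm]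
    exact mul_le_mul_of_nonneg_left h2 (norm_nonneg _)
  · fun_prop

/-- Fubini integrability of `a(x) g(y) Q(x, y)` for integrable `a`, when the slices
`g Q(x, ·)` have uniformly bounded integrals. -/
theorem integrable_prod_of_lintegral_le {n : ℕ} {g : E n →ₘ[volume] ℂ} {a : E n → ℂ}
    (hac : Continuous a) (ha : Integrable a) {Q : E n × E n → ℂ} (hQ : Continuous Q) {C : ℝ≥0}
    (hC : ∀ x, ∫⁻ y, ‖g y * Q (x, y)‖ₑ ≤ C) :
    Integrable (fun z : E n × E n => a z.1 * (g z.2 * Q z)) (volume.prod volume) := by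
  have hm : Measurable fun z : E n × E n => a z.1 * (g z.2 * Q z) :=
    (hac.measurable.comp measurable_fst).mul ((g.measurable.comp measurable_snd).mul hQ.measurable)
  refine ⟨hm.aestronglyMeasurable, ?_⟩
  rw [HasFiniteIntegral, lintegral_prod _ hm.enorm.aemeasurable]
  calc ∫⁻ x, ∫⁻ y, ‖a x * (g y * Q (x, y))‖ₑ ≤ ∫⁻ x, ‖a x‖ₑ * C := by
        refine lintegral_mono fun x => ?_
        simp_rw [enorm_mul (a x)]
        rw [lintegral_const_mul' _ _ enorm_ne_top]
        exact mul_le_mul_right (hC x) _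
    _ < ⊤ := by
        rw [lintegral_mul_const' _ _ ENNReal.coe_ne_top]
        exact ENNReal.mul_lt_top ha.2 ENNReal.coe_lt_top

/-- The Poisson extension of the distribution given by `g` is the pointwise convolution of `g`
with `P_t`. -/
theorem exists_isPoissonExtension {n : ℕ} {p : ℝ} (hp : 1 < p) {g : E n →ₘ[volume] ℂ}
    (hg : g ∈ weakLp n p) {f : 𝓢'(E n, ℂ)} (hf : IsGivenBy f g) :
    ∃ u : ℝ → (E n →ᵇ ℂ), IsPoissonExtension f u ∧
      ∀ t, 0 < t → ∀ x, u t x = ∫ y, g y * (poissonDilate t (x - y) : ℂ) := by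
  classical
  have hB : ∀ t, 0 < t → ∃ C : ℝ≥0, ∀ x, ∫⁻ y, ‖g y * (poissonDilate t (x - y) : ℂ)‖ₑ ≤ C :=
    fun t ht => exists_lintegral_enorm_mul_comp_sub_le hp hg (integrable_poissonDilate ht).ofReal
      ENNReal.ofReal_ne_top (enorm_poissonDilate_le ht)
  have hB' : ∀ t, 0 < t → ∃ C : ℝ, ∀ x, ‖∫ y, g y * (poissonDilate t (x - y) : ℂ)‖ ≤ C :=
    fun t ht => by
      obtain ⟨C, hC⟩ := hB t ht
      refine ⟨C, fun x => ?_⟩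
      have := (enorm_integral_le_lintegral_enorm
        (fun y => g y * (poissonDilate t (x - y) : ℂ))).trans (hC x)
      exact_mod_cast this
  choose C hC using hB'
  let u : ℝ → (E n →ᵇ ℂ) := fun t => if ht : 0 < t then
    BoundedContinuousFunction.ofNormedAddCommGroup _
      (continuous_integral_mul_poissonDilate hp hg ht) (C t ht) (hC t ht) else 0
  have hu : ∀ t, 0 < t → ∀ x, u t x = ∫ y, g y * (poissonDilate t (x - y) : ℂ) :=
    fun t ht x => by
      simp only [u, dif_pos ht]
      rfl
  refine ⟨u, fun t ht φ => ?_, hu⟩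
  have hcont := continuous_poissonDilate (n := n) t
  obtain ⟨C₁, hC₁⟩ := hB t ht
  obtain ⟨C₂, hC₂⟩ := exists_lintegral_enorm_mul_comp_sub_le hp hg (reflect φ).integrable
    ENNReal.ofReal_ne_top (enorm_schwartz_le_seminorm (reflect φ))
  have i1 := integrable_prod_of_lintegral_le (g := g) φ.continuous φ.integrable
    (Q := fun z => (poissonDilate t (z.1 - z.2) : ℂ)) (by fun_prop) hC₁
  have i2 := integrable_prod_of_lintegral_le (g := g) (a := fun x => (poissonDilate t (-x) : ℂ))
    (by fun_prop) (integrable_poissonDilate ht).comp_neg.ofReal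
    (Q := fun z => reflect φ (z.1 - z.2)) (by fun_prop) hC₂
  calc ∫ x, u t x * φ x
      = ∫ x, ∫ y, φ x * (g y * (poissonDilate t (x - y) : ℂ)) := by
        refine integral_congr_ae (.of_forall fun x => ?_)
        simp only
        rw [hu t ht, integral_const_mul, mul_comm]
    _ = ∫ y, ∫ x, φ x * (g y * (poissonDilate t (x - y) : ℂ)) := integral_integral_swap i1
    _ = ∫ y, ∫ x, (poissonDilate t (-x) : ℂ) * (g y * reflect φ (x - y)) := by
        refine integral_congr_ae (.of_forall fun y => ?_)
        simp only [reflect_apply]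
        rw [← integral_sub_left_eq_self
          (fun x => φ x * (g y * (poissonDilate t (x - y) : ℂ))) volume y]
        refine integral_congr_ae (.of_forall fun x => ?_)
        simp only
        rw [neg_sub, sub_sub_cancel_left]
        ring
    _ = ∫ x, ∫ y, (poissonDilate t (-x) : ℂ) * (g y * reflect φ (x - y)) :=
        (integral_integral_swap i2).symm
    _ = _ := by
        rw [distConv]
        refine integral_congr_ae (.of_forall fun x => ?_)
        simp only
        rw [integral_const_mul, schwartzConv_eq_integral hf]

theorem weakHardyNorm_le {n : ℕ} (hn : 0 < n) {p : ℝ} (hp : 1 < p) {g : E n →ₘ[volume] ℂ}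
    (hg : g ∈ weakLp n p) {f : 𝓢'(E n, ℂ)} (hf : IsGivenBy f g) :
    weakHardyNorm p f ≤ (poissonMaximalConst n + 1) * (2 * (5 ^ n * dyadicConst p) ^ (1 / p)) *
      weakLpNorm p g := by
  obtain ⟨u, hu, hug⟩ := exists_isPoissonExtension hp hg hf
  have hK : poissonMaximalConst n + 1 ≠ ⊤ :=
    ENNReal.add_ne_top.2 ⟨poissonMaximalConst_ne_top n, ENNReal.one_ne_top⟩
  -- adding `1` makes the factor visibly nonzero
  have hK0 : (poissonMaximalConst n + 1).toNNReal ≠ 0 :=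
    (ENNReal.toNNReal_pos (by simp) hK).ne'
  have hsup : ∀ x, verticalSup u x ≤
      ((poissonMaximalConst n + 1).toNNReal : ℝ≥0∞) * maximalFunction (fun y => ‖g y‖ₑ) x := by
    intro x
    rw [ENNReal.coe_toNNReal hK]
    refine iSup₂_le fun t ht => ?_
    rw [hug t ht]
    refine (enorm_integral_le_lintegral_enorm _).trans ?_
    calc ∫⁻ y, ‖g y * (poissonDilate t (x - y) : ℂ)‖ₑ
        = ∫⁻ y, ‖g y‖ₑ * ENNReal.ofReal (poissonDilate t (x - y)) := by
          refine lintegral_congr fun y => ?_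
          rw [enorm_mul, ← ofReal_norm (poissonDilate t (x - y) : ℂ), Complex.norm_real,
            Real.norm_of_nonneg (poissonDilate_pos ht _).le]
      _ ≤ poissonMaximalConst n * maximalFunction (fun y => ‖g y‖ₑ) x :=
          lintegral_mul_poissonDilate_le (measurable_enorm_aeeqFun g) ht x
      _ ≤ _ := mul_le_mul_left le_self_add _
  rw [weakHardyNorm_eq p hu]
  calc weakNorm p (verticalSup u)
      ≤ weakNorm p (fun x => ((poissonMaximalConst n + 1).toNNReal : ℝ≥0∞) *
          maximalFunction (fun y => ‖g y‖ₑ) x) :=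
        weakNorm_mono_ae (zero_lt_one.trans hp) (.of_forall hsup)
    _ ≤ (poissonMaximalConst n + 1) * weakNorm p (maximalFunction fun y => ‖g y‖ₑ) := by
        refine (weakNorm_const_mul_le hK0 _).trans_eq ?_
        rw [ENNReal.coe_toNNReal hK]
    _ ≤ (poissonMaximalConst n + 1) * (2 * (5 ^ n * dyadicConst p) ^ (1 / p) *
          weakNorm p (fun y => ‖g y‖ₑ)) :=
        mul_le_mul_right (weakNorm_maximalFunction_le hn hp (measurable_enorm_aeeqFun g)) _
    _ = _ := by rw [mul_assoc (poissonMaximalConst n + 1)]; rfl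

open Filter Topology

/-! ### Continuity of translations on Schwartz space -/

/-- Small translations move a Schwartz function by `O(‖h‖)` in every seminorm, by the mean value
inequality for its iterated derivatives. -/
theorem seminorm_compSubConst_sub_le {n : ℕ} (ψ : 𝓢(E n, ℂ)) (k m : ℕ) :
    ∃ C : ℝ, ∀ h : E n, ‖h‖ ≤ 1 →
      SchwartzMap.seminorm ℂ k m (ψ.compSubConstCLM ℂ h - ψ) ≤ C * ‖h‖ := by
  set D : ℝ := 2 ^ k *
    (Finset.Iic (k, m + 1)).sup (fun m => SchwartzMap.seminorm ℂ m.1 m.2) ψ with hD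
  have hD0 : 0 ≤ D := by positivity
  have hbound : ∀ x, (1 + ‖x‖) ^ k * ‖iteratedFDeriv ℝ (m + 1) ψ x‖ ≤ D := fun x =>
    one_add_le_sup_seminorm_apply (𝕜 := ℂ) (m := (k, m + 1)) le_rfl le_rfl ψ x
  refine ⟨2 ^ k * D, fun h hh => seminorm_le_bound ℂ k m _ (by positivity) fun x => ?_⟩
  have hψ : ContDiff ℝ m ψ := ψ.smooth m
  have hψ' : ContDiff ℝ m fun x => ψ (x - h) := hψ.comp (contDiff_id.sub contDiff_const)
  have e1 : iteratedFDeriv ℝ m (ψ.compSubConstCLM ℂ h - ψ) x =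
      iteratedFDeriv ℝ m ψ (x - h) - iteratedFDeriv ℝ m ψ x := by
    have h1 : (⇑(ψ.compSubConstCLM ℂ h - ψ) : E n → ℂ) = (fun x => ψ (x - h)) - ⇑ψ := rfl
    rw [h1, iteratedFDeriv_sub_apply hψ'.contDiffAt hψ.contDiffAt, iteratedFDeriv_comp_sub]
  have hmv : ‖iteratedFDeriv ℝ m ψ (x - h) - iteratedFDeriv ℝ m ψ x‖ ≤
      (2 ^ k * D / (1 + ‖x‖) ^ k) * ‖(x - h) - x‖ := by
    refine Convex.norm_image_sub_le_of_norm_fderiv_le (𝕜 := ℝ) (s := closedBall x 1)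
      (fun z _ => ?_) (fun z hz => ?_) (convex_closedBall x 1) (mem_closedBall_self zero_le_one) ?_
    · exact ((ψ.smooth (m + 1)).differentiable_iteratedFDeriv
        (by exact_mod_cast Nat.lt_succ_self m)) z
    · rw [norm_fderiv_iteratedFDeriv, le_div_iff₀ (by positivity)]
      have h2 : ‖x‖ ≤ ‖z‖ + 1 := by
        have h3 : ‖z - x‖ ≤ 1 := mem_closedBall_iff_norm.1 hz
        have h4 := norm_sub_norm_le x z
        rw [norm_sub_rev] at h4
        linarith
      have h5 : (1 + ‖x‖) ^ k ≤ (2 * (1 + ‖z‖)) ^ k :=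
        pow_le_pow_left₀ (by positivity) (by linarith [norm_nonneg z]) k
      calc ‖iteratedFDeriv ℝ (m + 1) ψ z‖ * (1 + ‖x‖) ^ k
          ≤ ‖iteratedFDeriv ℝ (m + 1) ψ z‖ * (2 * (1 + ‖z‖)) ^ k :=
            mul_le_mul_of_nonneg_left h5 (norm_nonneg _)
        _ = 2 ^ k * ((1 + ‖z‖) ^ k * ‖iteratedFDeriv ℝ (m + 1) ψ z‖) := by
            rw [mul_pow]
            ring
        _ ≤ _ := mul_le_mul_of_nonneg_left (hbound z) (by positivity)
    · rw [mem_closedBall_iff_norm]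
      simpa using hh
  rw [e1]
  have hx : ‖x‖ ^ k ≤ (1 + ‖x‖) ^ k :=
    pow_le_pow_left₀ (norm_nonneg x) (by linarith) k
  calc ‖x‖ ^ k * ‖iteratedFDeriv ℝ m ψ (x - h) - iteratedFDeriv ℝ m ψ x‖
      ≤ (1 + ‖x‖) ^ k * ((2 ^ k * D / (1 + ‖x‖) ^ k) * ‖(x - h) - x‖) :=
        mul_le_mul hx hmv (norm_nonneg _) (by positivity)
    _ = 2 ^ k * D * ‖h‖ := by
        rw [sub_sub_cancel_left, norm_neg]
        field_simp

theorem continuous_compSubConst {n : ℕ} (ψ : 𝓢(E n, ℂ)) :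
    Continuous fun a : E n => ψ.compSubConstCLM ℂ a := by
  refine continuous_iff_continuousAt.2 fun b => ?_
  refine ((schwartz_withSeminorms ℂ (E n) ℂ).tendsto_nhds _ _).2 fun i ε hε => ?_
  obtain ⟨C, hC⟩ := seminorm_compSubConst_sub_le (ψ.compSubConstCLM ℂ b) i.1 i.2
  have h1 : Tendsto (fun a : E n => C * ‖a - b‖) (𝓝 b) (𝓝 0) := by
    have : Continuous fun a : E n => C * ‖a - b‖ := by fun_prop
    simpa using this.tendsto b
  filter_upwards [h1.eventually_lt_const hε, closedBall_mem_nhds b one_pos] with a ha ha'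
  have h2 := hC (a - b) (mem_closedBall_iff_norm.1 ha')
  rw [compSubConstCLM_comp, add_sub_cancel] at h2
  exact h2.trans_lt ha

theorem continuous_schwartzConv {n : ℕ} (φ : 𝓢(E n, ℂ)) (f : 𝓢'(E n, ℂ)) :
    Continuous (schwartzConv φ f) :=
  (f : 𝓢(E n, ℂ) →L[ℂ] ℂ).continuous.comp (continuous_compSubConst (reflect φ))

/-! ### Boundary values of the Poisson extension -/

/-- The dilates `P_t` form an approximate identity up to the factor `∫ P`. -/
theorem tendsto_integral_poissonDilate_mul {n : ℕ} {F : E n → ℂ} (hF : Continuous F) {C : ℝ}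
    (hC : ∀ x, ‖F x‖ ≤ C) :
    Tendsto (fun t : ℝ => ∫ x, (poissonDilate t (-x) : ℂ) * F x) (𝓝[>] 0)
      (𝓝 (((∫ x : E n, poisson x : ℝ) : ℂ) * F 0)) := by
  have hscale : ∀ t : ℝ, 0 < t → ∫ x, (poisson (-x) : ℂ) * F (t • x) =
      ∫ x, (poissonDilate t (-x) : ℂ) * F x := fun t ht => by
    have h1 := Measure.integral_comp_smul (volume : Measure (E n))
      (fun x => (poissonDilate t (-x) : ℂ) * F x) t
    have h2 : ((t : ℂ) ^ n) ≠ 0 := by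
      exact_mod_cast (pow_pos ht n).ne'
    have h3 : ∫ x, (poissonDilate t (-(t • x)) : ℂ) * F (t • x) =
        ((t : ℂ) ^ n)⁻¹ * ∫ x, (poisson (-x) : ℂ) * F (t • x) := by
      rw [← integral_const_mul]
      refine integral_congr_ae (.of_forall fun x => ?_)
      simp only [poissonDilate, smul_neg, inv_smul_smul₀ ht.ne']
      push_cast
      ring
    rw [h3, finrank_euclideanSpace_fin, abs_of_pos (by positivity), Complex.real_smul] at h1
    push_cast at h1
    exact mul_left_cancel₀ (inv_ne_zero h2) h1
  have hlim : ((∫ x : E n, poisson x : ℝ) : ℂ) * F 0 = ∫ x : E n, (poisson (-x) : ℂ) * F 0 := by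
    rw [integral_mul_const, integral_complex_ofReal, integral_neg_eq_self (poisson : E n → ℝ)]
  rw [hlim]
  have hcont := continuous_poisson (n := n)
  have hlim2 : Tendsto (fun t : ℝ => ∫ x, (poisson (-x) : ℂ) * F (t • x)) (𝓝[>] 0)
      (𝓝 (∫ x : E n, (poisson (-x) : ℂ) * F 0)) := by
    refine tendsto_integral_filter_of_dominated_convergence (fun x => poisson (-x) * C)
      (.of_forall fun t => Continuous.aestronglyMeasurable (by fun_prop))
      (.of_forall fun t => .of_forall fun x => ?_)
      (integrable_poisson.comp_neg.mul_const C) (.of_forall fun x => ?_)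
    · rw [norm_mul, Complex.norm_real, Real.norm_of_nonneg (poisson_pos _).le]
      exact mul_le_mul_of_nonneg_left (hC _) (poisson_pos _).le
    · have h1 : Continuous fun t : ℝ => (poisson (-x) : ℂ) * F (t • x) := by fun_prop
      have h2 := h1.tendsto 0
      simp only [zero_smul] at h2
      exact h2.mono_left nhdsWithin_le_nhds
  refine hlim2.congr' ?_
  filter_upwards [self_mem_nhdsWithin] with t ht using hscale t ht

theorem schwartzConv_reflect_zero {n : ℕ} (φ : 𝓢(E n, ℂ)) (f : 𝓢'(E n, ℂ)) :
    schwartzConv (reflect φ) f 0 = f φ := by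
  have : (reflect (reflect φ)).compSubConstCLM ℂ 0 = φ := by
    ext x
    simp
  rw [schwartzConv, this]

theorem measurable_verticalSup {n : ℕ} (u : ℝ → (E n →ᵇ ℂ)) : Measurable (verticalSup u) :=
  (lowerSemicontinuous_iSup fun t => lowerSemicontinuous_iSup fun _ =>
    (u t).continuous.enorm.lowerSemicontinuous).measurable

/-- A bounded distribution is, up to the factor `∫ P`, the limit of its Poisson extension at the
boundary, and is therefore dominated by the maximal function. -/
theorem enorm_le_lintegral_verticalSup {n : ℕ} {f : 𝓢'(E n, ℂ)} (hf : IsBoundedDistribution f)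
    {u : ℝ → (E n →ᵇ ℂ)} (hu : IsPoissonExtension f u) (φ : 𝓢(E n, ℂ)) :
    ‖((∫ x : E n, poisson x : ℝ) : ℂ) * f φ‖ₑ ≤ ∫⁻ x, verticalSup u x * ‖φ x‖ₑ := by
  obtain ⟨C, hC⟩ := hf (reflect φ)
  have h1 := tendsto_integral_poissonDilate_mul (continuous_schwartzConv (reflect φ) f) hC
  rw [schwartzConv_reflect_zero] at h1
  refine le_of_tendsto h1.enorm ?_
  filter_upwards [self_mem_nhdsWithin] with t ht
  have h2 : ∫ x, (poissonDilate t (-x) : ℂ) * schwartzConv (reflect φ) f x = ∫ x, u t x * φ x :=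
    (hu t ht φ).symm
  rw [h2]
  refine (enorm_integral_le_lintegral_enorm _).trans (lintegral_mono fun x => ?_)
  rw [enorm_mul]
  exact mul_le_mul_left (le_iSup₂ (f := fun (t : ℝ) (_ : 0 < t) => ‖u t x‖ₑ) t ht) _

/-- The constant `(∫ P)⁻¹`, which equals `1`; only its positivity and finiteness matter. -/
noncomputable def poissonMassInv (n : ℕ) : ℝ≥0 := (∫ x : E n, poisson x).toNNReal⁻¹

theorem poissonMassInv_pos (n : ℕ) : 0 < poissonMassInv n :=
  inv_pos.2 (Real.toNNReal_pos.2 integral_poisson_pos)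

/-- Every element of `H^{p,∞}` is a function, controlled by the Poisson maximal function. -/
theorem exists_isGivenBy_of_mem_weakHardy {n : ℕ} {p : ℝ} (hp : 1 < p) {f : 𝓢'(E n, ℂ)}
    (hf : f ∈ weakHardy n p) : ∃ g : E n →ₘ[volume] ℂ, IsGivenBy f g ∧
      weakLpNorm p g ≤ poissonMassInv n * weakHardyNorm p f := by
  obtain ⟨hb, hfin⟩ := hf
  -- a finite infimum is over a nonempty family
  have hex : ∃ u : ℝ → (E n →ᵇ ℂ), IsPoissonExtension f u := by
    by_contra! hcon
    simp [weakHardyNorm, hcon] at hfin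
  obtain ⟨u, hu⟩ := hex
  rw [weakHardyNorm_eq p hu] at hfin ⊢
  set c : ℝ≥0 := poissonMassInv n with hc
  let V : E n → ℝ≥0∞ := fun x => c * verticalSup u x
  have hV : Measurable V := (measurable_verticalSup u).const_mul _
  have hVn : weakNorm p V ≤ c * weakNorm p (verticalSup u) :=
    weakNorm_const_mul_le (poissonMassInv_pos n).ne' _
  have hVfin : weakNorm p V < ⊤ := hVn.trans_lt (ENNReal.mul_lt_top ENNReal.coe_lt_top hfin)
  have hdom : ∀ φ : 𝓢(E n, ℂ), ‖f φ‖ₑ ≤ ∫⁻ x, V x * ‖φ x‖ₑ := fun φ => by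
    have h1 := mul_le_mul_right (enorm_le_lintegral_verticalSup hb hu φ) (c : ℝ≥0∞)
    have h2 : (c : ℝ≥0∞) * ‖((∫ x : E n, poisson x : ℝ) : ℂ)‖ₑ = 1 := by
      have h3 := Real.toNNReal_pos.2 (integral_poisson_pos (n := n))
      rw [← ofReal_norm, Complex.norm_real, Real.norm_of_nonneg integral_poisson_pos.le,
        ENNReal.ofReal, ← ENNReal.coe_mul, hc, poissonMassInv, inv_mul_cancel₀ h3.ne',
        ENNReal.coe_one]
    rw [enorm_mul, ← mul_assoc, h2, one_mul, ← lintegral_const_mul' _ _ ENNReal.coe_ne_top] at h1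
    simpa only [V, mul_assoc] using h1
  obtain ⟨g, hg, hgV⟩ := exists_isGivenBy_of_enorm_le f hV
    (ae_lt_top_of_weakNorm_lt_top hp hV hVfin)
    (hasTemperateGrowth_withDensity hp hV hVfin) hdom
  exact ⟨g, hg, (weakNorm_mono_ae (zero_lt_one.trans hp) hgV).trans hVn⟩

end WeakHardy

theorem mainTheorem7 (n : ℕ) (hn : 0 < n) (p : ℝ) (hp : 1 < p) :
    ∃ C : ℝ≥0, 0 < C ∧
      ∃ ι : (WeakHardy.E n →ₘ[volume] ℂ) → 𝓢'(WeakHardy.E n, ℂ),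
        (∀ g ∈ WeakHardy.weakLp n p, WeakHardy.IsGivenBy (ι g) g) ∧
        Set.BijOn ι (WeakHardy.weakLp n p) (WeakHardy.weakHardy n p) ∧
        ∀ g ∈ WeakHardy.weakLp n p,
          WeakHardy.weakHardyNorm p (ι g) ≤ C * WeakHardy.weakLpNorm p g ∧
          WeakHardy.weakLpNorm p g ≤ C * WeakHardy.weakHardyNorm p (ι g) := by
  classical
  open WeakHardy in
  set A : ℝ≥0∞ := (poissonMaximalConst n + 1) * (2 * (5 ^ n * dyadicConst p) ^ (1 / p)) with hA
  have hAtop : A ≠ ⊤ := by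
    refine ENNReal.mul_ne_top
      (ENNReal.add_ne_top.2 ⟨poissonMaximalConst_ne_top n, ENNReal.one_ne_top⟩)
      (ENNReal.mul_ne_top (by simp) (ENNReal.rpow_ne_top_of_nonneg (by positivity) ?_))
    exact ENNReal.mul_ne_top (by simp) (dyadicConst_ne_top hp)
  -- the value `0` is only taken at functions that do not define a tempered distribution
  let ι : (E n →ₘ[volume] ℂ) → 𝓢'(E n, ℂ) := fun g =>
    if h : ∃ f : 𝓢'(E n, ℂ), IsGivenBy f g then h.choose else 0
  have hι : ∀ g ∈ weakLp n p, IsGivenBy (ι g) g := fun g hg => by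
    have h := exists_isGivenBy hp hg
    simp only [ι, dif_pos h]
    exact h.choose_spec
  have hup : ∀ g ∈ weakLp n p, weakHardyNorm p (ι g) ≤ A * weakLpNorm p g := fun g hg =>
    weakHardyNorm_le hn hp hg (hι g hg)
  have hmaps : ∀ g ∈ weakLp n p, ι g ∈ weakHardy n p := fun g hg =>
    ⟨isBoundedDistribution_of_isGivenBy hp hg (hι g hg),
      (hup g hg).trans_lt (ENNReal.mul_lt_top hAtop.lt_top hg)⟩
  have hsurj : ∀ f ∈ weakHardy n p, ∃ g ∈ weakLp n p, IsGivenBy f g ∧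
      weakLpNorm p g ≤ poissonMassInv n * weakHardyNorm p f := fun f hf => by
    obtain ⟨g, hg, hle⟩ := exists_isGivenBy_of_mem_weakHardy hp hf
    exact ⟨g, hle.trans_lt (ENNReal.mul_lt_top ENNReal.coe_lt_top hf.2), hg, hle⟩
  have huniq : ∀ {f : 𝓢'(E n, ℂ)} {g k : E n →ₘ[volume] ℂ}, g ∈ weakLp n p → k ∈ weakLp n p →
      IsGivenBy f g → IsGivenBy f k → g = k := fun hg hk h1 h2 =>
    h1.unique h2 (locallyIntegrable_of_mem_weakLp hp hg) (locallyIntegrable_of_mem_weakLp hp hk)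
  refine ⟨A.toNNReal + poissonMassInv n, add_pos_of_nonneg_of_pos zero_le (poissonMassInv_pos n),
    ι, hι, ⟨hmaps, fun g hg k hk h => ?_, fun f hf => ?_⟩, fun g hg => ⟨?_, ?_⟩⟩
  · exact huniq hg hk (hι g hg) (h ▸ hι k hk)
  · obtain ⟨g, hg, hfg, -⟩ := hsurj f hf
    refine ⟨g, hg, ?_⟩
    ext φ
    rw [(hι g hg φ).2, (hfg φ).2]
  · rw [ENNReal.coe_add, ENNReal.coe_toNNReal hAtop]
    exact (hup g hg).trans (mul_le_mul_left le_self_add _)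
  · obtain ⟨k, hk, hfk, hle⟩ := hsurj (ι g) (hmaps g hg)
    obtain rfl := huniq hg hk (hι g hg) hfk
    rw [ENNReal.coe_add]
    exact hle.trans (mul_le_mul_left le_add_self _)
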